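/- **Setting.** Let $E=(E^0,E^1,r,s)$ be a finite directed multigraph without sinks or sources in which every cycle has an exit (some vertex on the cycle emits at least two edges). Paths $\mu=\mu_1\cdots\mu_k$ satisfy $r(\mu_j)=s(\mu_{j+1})$; vertices are the paths of length $0$; $E^*$ is the set of finite paths and $E^\infty$ the space of one-sided infinite paths, with the topology inherited from the product of discrete spaces. $L_{\mathbb Z}(E)$ is the Leavitt path algebra with generators $P_v,S_e,S_e^*$, where $S_e^*S_e=P_{r(e)}$ and $P_v=\sum_{s(e)=v}S_eS_e^*$, and $C^*(E)$ is the graph $C^*$-algebra with generators $p_v,s_e$ and the same relations. For a path $\mu=\mu_1\cdots\mu_k$ put $S_\mu=S_{\mu_1}\cdots S_{\mu_k}$, $S_v=P_v$, and similarly $s_\mu$; put $p_\mu=s_\mu s_\mu^*$. The diagonal $\mathcal D\subseteq C^*(E)$ is the $C^*$-subalgebra generated by all $p_\mu$, $\mu\in E^*$. Let $\mathcal J\subseteq E^*\times E^*$ be a finite set such that $s(\mu)=s(\nu)$, $r(\mu)=r(\nu)$ and $|\nu|\ge 1$ for all $(\mu,\nu)\in\mathcal J$, and such that $u=\sum_{(\mu,\nu)\in\mathcal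 J}S_\mu S_\nu^*$ is unitary in $L_{\mathbb Z}(E)$. Let $\lambda_u$ be the unital $*$-endomorphism of $C^*(E)$ with $\lambda_u(p_v)=p_v$ and $\lambda_u(s_e)=us_e$, where $u$ also denotes the image of $u$ under the canonical homomorphism $L_{\mathbb Z}(E)\to C^*(E)$. Write $(\mu,\nu)\in\mathcal J$ as $(\mu,e\kappa)$ with $e\in E^1$, where $\kappa\in E^*$ and $\kappa=r(e)$ if $|\nu|=1$. The coding graph $E_{\mathcal J}$ has vertex set $\mathcal J$ and exactly one edge from $(\mu_1,e_1\kappa_1)$ to $(\mu_2,e_2\kappa_2)$ if $S_{\kappa_1}^*S_{\mu_2}\neq0$, and none otherwise; this edge has the label $S_{\kappa_1}^*S_{\mu_2}$, and its degree is $|\alpha|$ if the label is $S_\alpha$ and $-|\alpha|$ if the label is $S_\alpha^*$. For a finite or infinite path $\omega$ in $E_{\mathcal J}$ that visits the vertices $(\mu_1,e_1\kappa_1),(\mu_2,e_2\kappa_2),\dots$ in this order, $\mathcal E(\omega)=e_1e_2\cdots$. Assume that all edges of $E_{\mathcal J}$ have non-negative degree, that $E_{\mathcal J}$ has no cycle consisting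 of edges of non-positive degree, and that $(E_{\mathcal J},\mathcal E)$ is left-synchronizing: there is $m\in\mathbb N$ such that any two paths of length $m$ in $E_{\mathcal J}$ with the same $\mathcal E$-label have the same source. A transducer with input alphabet $\mathcal A$ and output alphabet $\mathcal B$ (both finite) consists of a finite set of states $\mathcal S$, an initial state $s_0\in\mathcal S$ and a map $\tau\colon\mathcal S\times\mathcal A\to\mathcal S\times\mathcal B^*$. On input $\alpha=\alpha_1\alpha_2\cdots$ it defines $(s_i,\beta_i)=\tau(s_{i-1},\alpha_i)$, and $\alpha[T]\beta$ means that the concatenation $\beta_1\beta_2\cdots$ is the infinite word $\beta$. **Theorem.** The spectrum of $\mathcal D$ is homeomorphic to $E^\infty$, the path $\alpha\in E^\infty$ corresponding to the character that maps $p_\mu$ to $1$ if $\mu$ is an initial segment of $\alpha$ and to $0$ otherwise; and $\lambda_u$ restricts to an automorphism of $\mathcal D$. Let $\lambda_u^*$ be the homeomorphism of $E^\infty$ which under this identification is $\chi\mapsto\chi\circ\lambda_u|_{\mathcal D}$, and let $\psi_u=(\lambda_u^*)^{-1}$. Then there is a transducer $T$ with input and output alphabet $E^1$ such that $$\alpha[T]\psi_u(\alpha)\qquad\text{for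 all }\alpha\in E^\infty .$$ Moreover, $T$ may be taken to be a composition of transducers $T_2\circ T_1$ as follows. There is a sliding block code $\Phi\colon E^\infty\to E_{\mathcal J}^\infty$, that is, $\Phi(\alpha)_n=\varphi(\alpha_n\cdots\alpha_{n+N-1})$ for some $N$ and some map $\varphi\colon(E^1)^N\to E_{\mathcal J}^1$, with $\mathcal E(\Phi(\alpha))=\alpha$ and $\alpha[T_1]\Phi(\alpha)$ for all $\alpha\in E^\infty$. And $T_2$ is the labelling transducer with input alphabet $E_{\mathcal J}^1$ and output alphabet $E^1$, whose state is the last edge read: on the first edge $\omega_1$ it writes the path $\mu$ of the source $(\mu,e\kappa)$ of $\omega_1$, and on each later edge $\omega_{i+1}$ it writes a path $\gamma_i$, depending only on $\omega_i$, such that $S_{\gamma_i}$ is the label of $\omega_i$. -/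

import Mathlib

open scoped ENNReal CStarAlgebra

universe u

noncomputable section

/-! ## Finite directed graphs and their paths -/

/-- A directed multigraph with vertex set `V` and edge set `Ed`. -/
structure DiGraph (V Ed : Type u) where
  src : Ed → V
  tgt : Ed → V

namespace DiGraph

variable {V Ed : Type u}

/-- `l` is a composable list of edges whose first edge (if any) starts at `v`. -/
def IsPathFrom (E : DiGraph V Ed) : V → List Ed → Prop
  | _, [] => True
  | v, e :: l => E.src e = v ∧ E.IsPathFrom (E.tgt e) l

/-- The vertex reached from `v` by following the edges in `l`. -/
def endFrom (E : DiGraph V Ed) : V → List Ed → V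
  | v, [] => v
  | _, e :: l => E.endFrom (E.tgt e) l

/-- A finite path: its source, and the list of its edges. The paths of length `0` are the
vertices; for a path of positive length the source is determined by the first edge. -/
@[ext] structure FinPath (E : DiGraph V Ed) where
  start : V
  edges : List Ed
  isPath : E.IsPathFrom start edges

namespace FinPath

variable {E : DiGraph V Ed}

def length (μ : E.FinPath) : ℕ := μ.edges.length

/-- The range of a path. -/
def finish (μ : E.FinPath) : V := E.endFrom μ.start μ.edges

/-- The list of the vertices that a path visits, its source and its range included. -/
def vertices (μ : E.FinPath) : List V := μ.start :: μ.edges.map E.tgt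

/-- A cycle is a path of positive length whose range is its source. -/
def IsCycle (μ : E.FinPath) : Prop := 0 < μ.length ∧ μ.finish = μ.start

/-- The path `ν` in the decomposition `μ = e ν` of a path of positive length; if `μ = e` is a
single edge then `ν` is the vertex `r(e)`. -/
def tail : E.FinPath → E.FinPath
  | ⟨v, [], h⟩ => ⟨v, [], h⟩
  | ⟨_, e :: l, h⟩ => ⟨E.tgt e, l, h.2⟩

end FinPath

def NoSinks (E : DiGraph V Ed) : Prop := ∀ v, ∃ e, E.src e = v

def NoSources (E : DiGraph V Ed) : Prop := ∀ v, ∃ e, E.tgt e = v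

/-- Every cycle passes through a vertex that emits at least two distinct edges. -/
def CyclesHaveExits (E : DiGraph V Ed) : Prop :=
  ∀ μ : E.FinPath, μ.IsCycle →
    ∃ e ∈ μ.edges, ∃ f f' : Ed, f ≠ f' ∧ E.src f = E.src e ∧ E.src f' = E.src e

/-- The space `E^∞` of one-sided infinite paths. -/
def InfPath (E : DiGraph V Ed) : Type u :=
  {α : ℕ → Ed // ∀ n, E.tgt (α n) = E.src (α (n + 1))}

/-- The topology of `E^∞` as a subspace of the product of countably many copies of the discrete
space of edges. -/
instance (E : DiGraph V Ed) : TopologicalSpace E.InfPath :=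
  TopologicalSpace.induced Subtype.val (@Pi.topologicalSpace ℕ (fun _ => Ed) fun _ => ⊥)

/-- The finite path `μ` is an initial segment of the infinite path `α`; a vertex is an initial
segment of the infinite paths that start at it. -/
def FinPath.IsInitial {E : DiGraph V Ed} (μ : E.FinPath) (α : E.InfPath) : Prop :=
  E.src (α.1 0) = μ.start ∧ ∀ (i : ℕ) (h : i < μ.edges.length), μ.edges[i] = α.1 i

end DiGraph

open DiGraph

variable {V Ed : Type u}

/-! ## The Leavitt path algebra over the integers -/

/-- Generators of the Leavitt path algebra: `P_v`, `S_e` and `S_e^*`. -/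
inductive LeavittGen (V Ed : Type u) : Type u
  | vert (v : V)
  | edge (e : Ed)
  | ghost (e : Ed)

section Leavitt

variable [Fintype V] [Fintype Ed] (E : DiGraph V Ed)

/-- The free ring on the generators. -/
abbrev LeavittFree (V Ed : Type u) : Type u := FreeAlgebra ℤ (LeavittGen V Ed)

namespace LeavittFree

abbrev P (v : V) : LeavittFree V Ed := FreeAlgebra.ι ℤ (.vert v)
abbrev S (e : Ed) : LeavittFree V Ed := FreeAlgebra.ι ℤ (.edge e)
abbrev Sstar (e : Ed) : LeavittFree V Ed := FreeAlgebra.ι ℤ (.ghost e)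

end LeavittFree

open LeavittFree in
open Classical in
/-- The relations of the Leavitt path algebra. The relation `unit` says that the unit of the free
(unital) ring becomes `∑ P_v`, which is the unit of the Leavitt path algebra of a finite graph. -/
inductive LeavittRel : LeavittFree V Ed → LeavittFree V Ed → Prop
  | idem (v : V) : LeavittRel (P v * P v) (P v)
  | orth (v w : V) (h : v ≠ w) : LeavittRel (P v * P w) 0
  | lpa1 (e f : Ed) (h : e ≠ f) : LeavittRel (Sstar e * S f) 0
  | lpa2 (e : Ed) : LeavittRel (Sstar e * S e) (P (E.tgt e))
  | lpa3_left (e : Ed) : LeavittRel (P (E.src e) * S e) (S e)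
  | lpa3_right (e : Ed) : LeavittRel (S e * P (E.tgt e)) (S e)
  | lpa4_left (e : Ed) : LeavittRel (P (E.tgt e) * Sstar e) (Sstar e)
  | lpa4_right (e : Ed) : LeavittRel (Sstar e * P (E.src e)) (Sstar e)
  | lpa5 (v : V) (h : ∃ e, E.src e = v) :
      LeavittRel (P v) (∑ e with E.src e = v, S e * Sstar e)
  | unit : LeavittRel (∑ v, P v) 1

/-- The Leavitt path algebra `L_ℤ(E)`. -/
def Leavitt : Type u := RingQuot (LeavittRel E)

instance : Ring (Leavitt E) := inferInstanceAs (Ring (RingQuot (LeavittRel E)))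

namespace Leavitt

variable {E}

/-- The quotient map. -/
def mk : LeavittFree V Ed →+* Leavitt E := RingQuot.mkRingHom (LeavittRel E)

def P (v : V) : Leavitt E := mk (LeavittFree.P v)
def S (e : Ed) : Leavitt E := mk (LeavittFree.S e)
def Sstar (e : Ed) : Leavitt E := mk (LeavittFree.Sstar e)

lemma mk_rel {a b : LeavittFree V Ed} (h : LeavittRel E a b) : (mk a : Leavitt E) = mk b :=
  RingQuot.mkRingHom_rel h

lemma P_idem (v : V) : (P v : Leavitt E) * P v = P v := by
  have := mk_rel (LeavittRel.idem (E := E) v)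
  rwa [map_mul] at this

lemma P_orth {v w : V} (h : v ≠ w) : (P v : Leavitt E) * P w = 0 := by
  have := mk_rel (LeavittRel.orth (E := E) v w h)
  rwa [map_mul, map_zero] at this

/-- Universal property: elements of a ring that satisfy the relations define a homomorphism. -/
def lift {B : Type*} [Ring B] (g : LeavittGen V Ed → B)
    (hg : ∀ a b, LeavittRel E a b → FreeAlgebra.lift ℤ g a = FreeAlgebra.lift ℤ g b) :
    Leavitt E →+* B :=
  RingQuot.lift ⟨(FreeAlgebra.lift ℤ g : LeavittFree V Ed →+* B), fun {a b} h => hg a b h⟩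

lemma lift_mk {B : Type*} [Ring B] (g : LeavittGen V Ed → B)
    (hg : ∀ a b, LeavittRel E a b → FreeAlgebra.lift ℤ g a = FreeAlgebra.lift ℤ g b)
    (a : LeavittFree V Ed) : lift g hg (mk a) = FreeAlgebra.lift ℤ g a := by
  exact RingQuot.lift_mkRingHom_apply _ _ _

lemma hom_ext {B : Type*} [Ring B] {f g : Leavitt E →+* B} (hP : ∀ v, f (P v) = g (P v))
    (hS : ∀ e, f (S e) = g (S e)) (hS' : ∀ e, f (Sstar e) = g (Sstar e)) : f = g := by
  apply RingQuot.ringQuot_ext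
  let f' : LeavittFree V Ed →ₐ[ℤ] B := (f.comp mk).toIntAlgHom
  let g' : LeavittFree V Ed →ₐ[ℤ] B := (g.comp mk).toIntAlgHom
  have h : f' = g' := by
    apply FreeAlgebra.hom_ext
    funext x
    cases x with
    | vert v => exact hP v
    | edge e => exact hS e
    | ghost e => exact hS' e
  ext x
  exact DFunLike.congr_fun h x

/-- The images of the generators under the involution, in the opposite ring. -/
def opGen : LeavittGen V Ed → (Leavitt E)ᵐᵒᵖ
  | .vert v => .op (P v)
  | .edge e => .op (Sstar e)
  | .ghost e => .op (S e)

open Classical in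
/-- The involution, as a homomorphism to the opposite ring: it fixes `P_v` and exchanges `S_e` and
`S_e^*`. -/
def starHom : Leavitt E →+* (Leavitt E)ᵐᵒᵖ :=
  lift opGen (by
    intro a b h
    have key := mk_rel h
    apply MulOpposite.unop_injective
    cases h with
    | idem v => simpa [opGen, P] using key
    | orth v w hne =>
      have := mk_rel (LeavittRel.orth (E := E) w v hne.symm)
      simpa [opGen, P] using this
    | lpa1 e f hne =>
      have := mk_rel (LeavittRel.lpa1 (E := E) f e hne.symm)
      simpa [opGen, S, Sstar] using this
    | lpa2 e => simpa [opGen, S, Sstar, P] using key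
    | lpa3_left e =>
      simpa [opGen, S, Sstar, P] using mk_rel (LeavittRel.lpa4_right (E := E) e)
    | lpa3_right e =>
      simpa [opGen, S, Sstar, P] using mk_rel (LeavittRel.lpa4_left (E := E) e)
    | lpa4_left e =>
      simpa [opGen, S, Sstar, P] using mk_rel (LeavittRel.lpa3_right (E := E) e)
    | lpa4_right e =>
      simpa [opGen, S, Sstar, P] using mk_rel (LeavittRel.lpa3_left (E := E) e)
    | lpa5 v hv => simpa [opGen, S, Sstar, P] using key
    | unit => simpa [opGen, P] using key)

lemma starHom_P (v : V) : starHom (P v : Leavitt E) = .op (P v) := by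
  simp [starHom, P, lift_mk, opGen]

lemma starHom_S (e : Ed) : starHom (S e : Leavitt E) = .op (Sstar e) := by
  simp [starHom, S, lift_mk, opGen]

lemma starHom_Sstar (e : Ed) : starHom (Sstar e : Leavitt E) = .op (S e) := by
  simp [starHom, Sstar, lift_mk, opGen]

lemma starHom_starHom :
    ((RingEquiv.opOp (Leavitt E)).symm : _ →+* _).comp
      ((RingHom.op (starHom (E := E))).comp starHom) = RingHom.id (Leavitt E) := by
  apply hom_ext <;> intro a <;> simp [starHom_P, starHom_S, starHom_Sstar, RingHom.op]

/-- The involution of `L_ℤ(E)`. -/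
instance : StarRing (Leavitt E) where
  star x := (starHom x).unop
  star_involutive x := DFunLike.congr_fun starHom_starHom x
  star_mul x y := by simp
  star_add x y := by simp

lemma star_P (v : V) : star (P v : Leavitt E) = P v := by
  change (starHom _).unop = _
  rw [starHom_P]; rfl

lemma star_S (e : Ed) : star (S e : Leavitt E) = Sstar e := by
  change (starHom _).unop = _
  rw [starHom_S]; rfl

/-- The element `S_μ` for a finite path `μ`; the leading factor makes `S_v = P_v` for a vertex `v`,
and is redundant for paths of positive length. -/
def path (μ : E.FinPath) : Leavitt E := P μ.start * (μ.edges.map S).prod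

end Leavitt

end Leavitt

/-! ## The graph C*-algebra -/

section GraphCStar

variable [Fintype V] [Fintype Ed] (E : DiGraph V Ed)

open Classical in
/-- Families of mutually orthogonal projections `p_v` and of partial isometries `s_e` that satisfy
the relations of the C*-algebra of a finite graph. The universal C*-algebra generated by such
elements has the unit `∑ p_v`, so the families considered in a unital algebra have `∑ p_v = 1`. -/
structure CKFamily (A : Type*) [CStarAlgebra A] where
  p : V → A
  s : Ed → A
  proj : ∀ v, IsStarProjection (p v)
  orth : ∀ v w, v ≠ w → p v * p w = 0
  gca1 : ∀ e, star (s e) * s e = p (E.tgt e)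
  gca2 : ∀ v, p v = ∑ e with E.src e = v, s e * star (s e)
  unit : ∑ v, p v = 1

namespace CKFamily

variable {E} {A : Type*} [CStarAlgebra A] (F : CKFamily E A)

lemma s_mul_p (e : Ed) : F.s e * F.p (E.tgt e) = F.s e := by
  have hp := F.proj (E.tgt e)
  have h : star (F.s e * F.p (E.tgt e) - F.s e) * (F.s e * F.p (E.tgt e) - F.s e) = 0 := by
    have h1 := F.gca1 e
    have h2 : F.p (E.tgt e) * F.p (E.tgt e) = F.p (E.tgt e) := hp.isIdempotentElem
    have h3 : star (F.p (E.tgt e)) = F.p (E.tgt e) := hp.isSelfAdjoint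
    simp only [star_sub, star_mul, h3, sub_mul, mul_sub]
    simp only [mul_assoc, ← mul_assoc (star (F.s e)) (F.s e), h1, h2]
    simp
  exact sub_eq_zero.mp (CStarRing.star_mul_self_eq_zero_iff _ |>.mp h)

lemma range_proj (e : Ed) : IsStarProjection (F.s e * star (F.s e)) where
  isIdempotentElem := by
    rw [IsIdempotentElem, ← mul_assoc, mul_assoc (F.s e), F.gca1, F.s_mul_p]
  isSelfAdjoint := by simp [IsSelfAdjoint]

lemma p_mul_range (e : Ed) :
    F.p (E.src e) * (F.s e * star (F.s e)) = F.s e * star (F.s e) := by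
  classical
  let _ : PartialOrder A := CStarAlgebra.spectralOrder A
  have _ : StarOrderedRing A := CStarAlgebra.spectralOrderedRing A
  refine ((F.range_proj e).le_iff_mul_eq_right (F.proj _)).mp ?_
  rw [F.gca2 (E.src e)]
  exact Finset.single_le_sum (f := fun e => F.s e * star (F.s e))
    (fun i _ => (F.range_proj i).nonneg) (by simp)

lemma p_mul_s (e : Ed) : F.p (E.src e) * F.s e = F.s e := by
  have h : F.s e = F.s e * star (F.s e) * F.s e := by
    rw [mul_assoc, F.gca1, F.s_mul_p]
  rw [h, ← mul_assoc, F.p_mul_range]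

lemma range_mul_range {e f : Ed} (h : e ≠ f) (hs : E.src e = E.src f) :
    (F.s e * star (F.s e)) * (F.s f * star (F.s f)) = 0 := by
  classical
  let _ : PartialOrder A := CStarAlgebra.spectralOrder A
  have _ : StarOrderedRing A := CStarAlgebra.spectralOrderedRing A
  have hle : F.s e * star (F.s e) + F.s f * star (F.s f) ≤ 1 := by
    refine le_trans ?_ (F.proj (E.src e)).le_one
    rw [F.gca2 (E.src e), ← Finset.sum_pair (f := fun e => F.s e * star (F.s e)) h]
    refine Finset.sum_le_sum_of_subset_of_nonneg ?_ fun i _ _ => (F.range_proj i).nonneg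
    intro i hi
    simp only [Finset.mem_insert, Finset.mem_singleton] at hi
    rcases hi with rfl | rfl <;> simp [hs]
  have h1 := ((F.range_proj f).le_iff_mul_eq_right (F.range_proj e).one_sub).mp
    (le_sub_iff_add_le'.mpr hle)
  rw [sub_mul, one_mul, sub_eq_self] at h1
  exact h1

lemma star_s_mul_s {e f : Ed} (h : e ≠ f) : star (F.s e) * F.s f = 0 := by
  by_cases hs : E.src e = E.src f
  · have h1 : star (F.s e) * ((F.s e * star (F.s e)) * (F.s f * star (F.s f))) * F.s f = 0 := by
      rw [F.range_mul_range h hs]; simp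
    have h2 : F.s f * star (F.s f) * F.s f = F.s f := by rw [mul_assoc, F.gca1, F.s_mul_p]
    have h3 : star (F.s e) * (F.s e * star (F.s e)) = star (F.s e) := by
      rw [← mul_assoc, F.gca1]
      simpa [(F.proj (E.tgt e)).isSelfAdjoint.star_eq] using congr(star $(F.s_mul_p e))
    rwa [← mul_assoc, h3, mul_assoc, h2] at h1
  · rw [← F.p_mul_s e, ← F.p_mul_s f, star_mul, (F.proj _).isSelfAdjoint.star_eq, mul_assoc,
      ← mul_assoc (F.p _), F.orth _ _ hs]
    simp

open Classical in
/-- The homomorphism from the Leavitt path algebra that sends generators to generators. -/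
def ofLeavitt : Leavitt E →+* A :=
  Leavitt.lift
    (fun
      | .vert v => F.p v
      | .edge e => F.s e
      | .ghost e => star (F.s e))
    (by
      have hs : ∀ e, F.p (E.tgt e) * star (F.s e) = star (F.s e) := fun e => by
        simpa [(F.proj (E.tgt e)).isSelfAdjoint.star_eq] using congr(star $(F.s_mul_p e))
      have hs' : ∀ e, star (F.s e) * F.p (E.src e) = star (F.s e) := fun e => by
        simpa [(F.proj (E.src e)).isSelfAdjoint.star_eq] using congr(star $(F.p_mul_s e))
      intro a b h
      cases h with
      | idem v => simpa using (F.proj v).isIdempotentElem.eq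
      | orth v w h => simpa using F.orth v w h
      | lpa1 e f h => simpa using F.star_s_mul_s h
      | lpa2 e => simpa using F.gca1 e
      | lpa3_left e => simpa using F.p_mul_s e
      | lpa3_right e => simpa using F.s_mul_p e
      | lpa4_left e => simpa using hs e
      | lpa4_right e => simpa using hs' e
      | lpa5 v h => simpa using F.gca2 v
      | unit => simpa using F.unit)

lemma ofLeavitt_P (v : V) : F.ofLeavitt (Leavitt.P v) = F.p v := by
  simp [ofLeavitt, Leavitt.P, Leavitt.lift_mk]

lemma ofLeavitt_S (e : Ed) : F.ofLeavitt (Leavitt.S e) = F.s e := by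
  simp [ofLeavitt, Leavitt.S, Leavitt.lift_mk]

lemma ofLeavitt_Sstar (e : Ed) : F.ofLeavitt (Leavitt.Sstar e) = star (F.s e) := by
  simp [ofLeavitt, Leavitt.Sstar, Leavitt.lift_mk]

lemma ofLeavitt_star (x : Leavitt E) : F.ofLeavitt (star x) = star (F.ofLeavitt x) := by
  have h : (RingHom.op F.ofLeavitt).comp Leavitt.starHom =
      ((starRingEquiv : A ≃+* Aᵐᵒᵖ) : A →+* Aᵐᵒᵖ).comp F.ofLeavitt := by
    apply Leavitt.hom_ext <;> intro a <;>
      simp [RingHom.op, Leavitt.starHom_P, Leavitt.starHom_S, Leavitt.starHom_Sstar,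
        ofLeavitt_P, ofLeavitt_S, ofLeavitt_Sstar, (F.proj _).isSelfAdjoint.star_eq]
  exact congrArg MulOpposite.unop (DFunLike.congr_fun h x)

/-- The element `s_μ` for a finite path `μ`. -/
def path (μ : E.FinPath) : A := F.p μ.start * (μ.edges.map F.s).prod

/-- For a unitary `u` that commutes with all `p_v`, the elements `p_v` and `u s_e` satisfy the same
relations. -/
@[simps] def twist (u : A) (hu : u ∈ unitary A) (hc : ∀ v, Commute u (F.p v)) : CKFamily E A where
  p := F.p
  s e := u * F.s e
  proj := F.proj
  orth := F.orth
  gca1 e := by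
    rw [star_mul, mul_assoc, ← mul_assoc (star u), Unitary.star_mul_self_of_mem hu, one_mul, F.gca1]
  gca2 v := by
    have h : ∀ e, u * F.s e * star (u * F.s e) = u * (F.s e * star (F.s e)) * star u := fun e => by
      rw [star_mul]; simp only [mul_assoc]
    simp only [h]
    rw [← Finset.sum_mul, ← Finset.mul_sum, ← F.gca2, (hc v).eq, mul_assoc,
      Unitary.mul_star_self_of_mem hu, mul_one]
  unit := F.unit

end CKFamily

/-- All families in nonzero unital C*-algebras (of a fixed universe). -/
structure CKRep where
  carrier : Type u
  [alg : CStarAlgebra carrier]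
  [nontriv : Nontrivial carrier]
  fam : CKFamily E carrier

attribute [instance] CKRep.alg CKRep.nontriv

/-- The C*-algebra of all bounded elements of the product of all these algebras. -/
abbrev CKProduct : Type (u + 1) := lp (fun i : CKRep E => i.carrier) ∞

instance : CStarAlgebra (CKProduct E) where

namespace CKProduct

variable {E}

/-- The element with given components of norm at most `1`. -/
def mk (f : ∀ i : CKRep E, i.carrier) (hf : ∀ i, ‖f i‖ ≤ 1) : CKProduct E :=
  ⟨f, memℓp_infty ⟨1, by rintro _ ⟨i, rfl⟩; exact hf i⟩⟩

def p (v : V) : CKProduct E := mk (fun i => i.fam.p v) fun i => (i.fam.proj v).norm_le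

def s (e : Ed) : CKProduct E := mk (fun i => i.fam.s e) fun i => by
  have h : ‖i.fam.s e‖ * ‖i.fam.s e‖ ≤ 1 := by
    rw [← CStarRing.norm_star_mul_self, i.fam.gca1]; exact (i.fam.proj _).norm_le
  nlinarith [norm_nonneg (i.fam.s e)]

variable (E) in
/-- The C*-algebra generated by the `p_v` and the `s_e`. -/
def generated : StarSubalgebra ℂ (CKProduct E) :=
  (StarAlgebra.adjoin ℂ (Set.range p ∪ Set.range s)).topologicalClosure

instance : IsClosed (generated E : Set (CKProduct E)) :=
  StarSubalgebra.isClosed_topologicalClosure _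

lemma p_mem (v : V) : p v ∈ generated E :=
  StarSubalgebra.le_topologicalClosure _ (StarAlgebra.subset_adjoin _ _ (.inl ⟨v, rfl⟩))

lemma s_mem (e : Ed) : s e ∈ generated E :=
  StarSubalgebra.le_topologicalClosure _ (StarAlgebra.subset_adjoin _ _ (.inr ⟨e, rfl⟩))

/-- Reindexing along a map of families that keeps the algebra. -/
def reindex (F : ∀ i : CKRep E, CKFamily E i.carrier) : CKProduct E →⋆ₐ[ℂ] CKProduct E where
  toFun x := ⟨fun i => x ⟨i.carrier, F i⟩, memℓp_infty (by
    obtain ⟨C, hC⟩ := memℓp_infty_iff.mp (lp.memℓp x)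
    exact ⟨C, by rintro _ ⟨i, rfl⟩; exact hC ⟨⟨i.carrier, F i⟩, rfl⟩⟩)⟩
  map_one' := rfl
  map_mul' _ _ := rfl
  map_zero' := rfl
  map_add' _ _ := rfl
  commutes' _ := rfl
  map_star' _ := rfl

lemma reindex_apply (F : ∀ i : CKRep E, CKFamily E i.carrier) (x : CKProduct E) (i : CKRep E) :
    reindex F x i = x ⟨i.carrier, F i⟩ := rfl

end CKProduct

/-- The graph C*-algebra `C^*(E)`: the C*-algebra generated by the universal family, which lives in
the product of all families. Its universal property is `GraphCStar.lift`. -/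
def GraphCStar : Type (u + 1) := CKProduct.generated E

instance : CStarAlgebra (GraphCStar E) := inferInstanceAs (CStarAlgebra (CKProduct.generated E))

namespace GraphCStar

variable {E}

/-- The inclusion into the product. -/
def incl : GraphCStar E →⋆ₐ[ℂ] CKProduct E := (CKProduct.generated E).subtype

lemma incl_injective : Function.Injective (incl (E := E)) := Subtype.val_injective

/-- The component of an element at a family. -/
def eval (i : CKRep E) : GraphCStar E →⋆ₐ[ℂ] i.carrier where
  toFun x := incl x i
  map_one' := rfl
  map_mul' _ _ := rfl
  map_zero' := rfl
  map_add' _ _ := rfl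
  commutes' _ := rfl
  map_star' _ := rfl

lemma eval_ext {x y : GraphCStar E} (h : ∀ i, eval i x = eval i y) : x = y :=
  incl_injective (lp.ext (funext h))

/-- The generator `p_v`. -/
def p (v : V) : GraphCStar E := ⟨CKProduct.p v, CKProduct.p_mem v⟩

/-- The generator `s_e`. -/
def s (e : Ed) : GraphCStar E := ⟨CKProduct.s e, CKProduct.s_mem e⟩

/-- The universal family of generators. -/
def univ : CKFamily E (GraphCStar E) where
  p := p
  s := s
  proj v :=
    ⟨eval_ext fun i => (i.fam.proj v).isIdempotentElem,
      eval_ext fun i => (i.fam.proj v).isSelfAdjoint⟩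
  orth v w h := eval_ext fun i => i.fam.orth v w h
  gca1 e := eval_ext fun i => i.fam.gca1 e
  gca2 v := eval_ext fun i => by
    rw [map_sum]; exact i.fam.gca2 v
  unit := eval_ext fun i => by
    rw [map_sum, map_one]; exact i.fam.unit

lemma eval_p (i : CKRep E) (v : V) : eval i (univ.p v) = i.fam.p v := rfl

lemma eval_s (i : CKRep E) (e : Ed) : eval i (univ.s e) = i.fam.s e := rfl

/-- Two homomorphisms that agree on the generators are equal. -/
lemma hom_ext {B : Type*} [CStarAlgebra B] {f g : GraphCStar E →⋆ₐ[ℂ] B}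
    (hp : ∀ v, f (univ.p v) = g (univ.p v)) (hs : ∀ e, f (univ.s e) = g (univ.s e)) : f = g := by
  have hf : Continuous f := map_continuous f
  have hg : Continuous g := map_continuous g
  let f' : (StarAlgebra.adjoin ℂ (Set.range CKProduct.p ∪ Set.range
    (CKProduct.s (E := E)))).topologicalClosure →⋆ₐ[ℂ] B := f
  let g' : (StarAlgebra.adjoin ℂ (Set.range CKProduct.p ∪ Set.range
    (CKProduct.s (E := E)))).topologicalClosure →⋆ₐ[ℂ] B := g
  refine StarAlgHom.ext_topologicalClosure (φ := f') (ψ := g') hf hg ?_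
  refine StarAlgHom.ext_adjoin ?_
  rintro ⟨x, _⟩ (⟨v, rfl⟩ | ⟨e, rfl⟩)
  · exact hp v
  · exact hs e

/-- The universal property of `C^*(E)`. -/
theorem lift {A : Type u} [CStarAlgebra A] [Nontrivial A] (F : CKFamily E A) :
    ∃! f : GraphCStar E →⋆ₐ[ℂ] A, (∀ v, f (univ.p v) = F.p v) ∧ ∀ e, f (univ.s e) = F.s e :=
  ⟨eval ⟨A, F⟩, ⟨fun _ => rfl, fun _ => rfl⟩, fun _ hg =>
    hom_ext (fun v => hg.1 v) (fun e => hg.2 e)⟩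

/-- All families, with `s_e` replaced by `u s_e`. -/
def twisted (u : GraphCStar E) (hu : u ∈ unitary (GraphCStar E))
    (hc : ∀ v, Commute u (univ.p v)) (i : CKRep E) : CKFamily E i.carrier :=
  i.fam.twist (eval i u) (Unitary.map_mem (eval i) hu) fun v => (hc v).map (eval i)

lemma reindex_mem (u : GraphCStar E) (hu : u ∈ unitary (GraphCStar E))
    (hc : ∀ v, Commute u (univ.p v)) {x : CKProduct E} (hx : x ∈ CKProduct.generated E) :
    CKProduct.reindex (twisted u hu hc) x ∈ CKProduct.generated E := by
  have hcont : Continuous (CKProduct.reindex (twisted u hu hc)) := map_continuous _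
  have hle : CKProduct.generated E ≤
      (CKProduct.generated E).comap (CKProduct.reindex (twisted u hu hc)) := by
    refine StarSubalgebra.topologicalClosure_minimal ?_ ?_
    · refine StarAlgebra.adjoin_le ?_
      rintro _ (⟨v, rfl⟩ | ⟨e, rfl⟩)
      · exact CKProduct.p_mem v
      · exact mul_mem u.2 (CKProduct.s_mem e)
    · exact (inferInstance : IsClosed (CKProduct.generated E : Set (CKProduct E))).preimage hcont
  exact hle hx

/-- For a unitary `u` that commutes with all `p_v`, the endomorphism `λ_u` of `C^*(E)`. It is
determined by `lambda_p` and `lambda_s`. -/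
def lambda (u : GraphCStar E) (hu : u ∈ unitary (GraphCStar E)) (hc : ∀ v, Commute u (univ.p v)) :
    GraphCStar E →⋆ₐ[ℂ] GraphCStar E :=
  StarAlgHom.codRestrict ((CKProduct.reindex (twisted u hu hc)).comp incl) (CKProduct.generated E)
    fun x => reindex_mem u hu hc x.2

lemma lambda_p (u : GraphCStar E) (hu : u ∈ unitary (GraphCStar E))
    (hc : ∀ v, Commute u (univ.p v)) (v : V) : lambda u hu hc (univ.p v) = univ.p v := rfl

lemma lambda_s (u : GraphCStar E) (hu : u ∈ unitary (GraphCStar E))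
    (hc : ∀ v, Commute u (univ.p v)) (e : Ed) :
    lambda u hu hc (univ.s e) = u * univ.s e := rfl

/-- The diagonal subalgebra `D`: the C*-subalgebra generated by the range projections
`p_μ = s_μ s_μ^*` of all finite paths `μ`. -/
def diagonal (E : DiGraph V Ed) : StarSubalgebra ℂ (GraphCStar E) :=
  (StarAlgebra.adjoin ℂ
    (Set.range fun μ : E.FinPath => univ.path μ * star (univ.path μ))).topologicalClosure

instance : IsClosed (diagonal E : Set (GraphCStar E)) :=
  StarSubalgebra.isClosed_topologicalClosure _

/-- The range projection `p_μ`, as an element of the diagonal. -/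
def rangeProj (μ : E.FinPath) : diagonal E :=
  ⟨univ.path μ * star (univ.path μ),
    StarSubalgebra.le_topologicalClosure _ (StarAlgebra.subset_adjoin _ _ ⟨μ, rfl⟩)⟩

/-- `Γ` is the identification of `E^∞` with the spectrum of the diagonal: the infinite path `α`
corresponds to the character that maps `p_μ` to `1` if `μ` is an initial segment of `α`, and to `0`
otherwise. -/
def IsPathSpectrum (Γ : E.InfPath ≃ₜ WeakDual.characterSpace ℂ (diagonal E)) : Prop :=
  ∀ (α : E.InfPath) (μ : E.FinPath),
    (μ.IsInitial α → Γ α (rangeProj μ) = 1) ∧ (¬ μ.IsInitial α → Γ α (rangeProj μ) = 0)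

open WeakDual in
/-- Gelfand duality: the homeomorphism `φ ↦ φ ∘ Λ` of the spectrum of the diagonal that is induced
by an automorphism `Λ` of the diagonal. -/
def spectrumHomeo (Λ : diagonal E ≃⋆ₐ[ℂ] diagonal E) :
    characterSpace ℂ (diagonal E) ≃ₜ characterSpace ℂ (diagonal E) where
  toFun := CharacterSpace.compContinuousMap (Λ : diagonal E →⋆ₐ[ℂ] diagonal E)
  invFun := CharacterSpace.compContinuousMap (Λ.symm : diagonal E →⋆ₐ[ℂ] diagonal E)
  left_inv φ := by
    apply CharacterSpace.ext; intro x
    simp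
  right_inv φ := by
    apply CharacterSpace.ext; intro x
    simp
  continuous_toFun := map_continuous _
  continuous_invFun := map_continuous _

/-- The homeomorphism of `E^∞` that corresponds to an automorphism of the diagonal. -/
def pathHomeo (Γ : E.InfPath ≃ₜ WeakDual.characterSpace ℂ (diagonal E))
    (Λ : diagonal E ≃⋆ₐ[ℂ] diagonal E) : E.InfPath ≃ₜ E.InfPath :=
  (Γ.trans (spectrumHomeo Λ)).trans Γ.symm

end GraphCStar

end GraphCStar

/-! ## Polynomial unitaries and their coding graphs -/

/-- A finite set of pairs of paths `(μ, ν)` with `s(μ) = s(ν)`, `r(μ) = r(ν)`, in which each `ν` has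
positive length and thus can be written as `ν = e κ` with an edge `e`. -/
structure CodingSet (E : DiGraph V Ed) where
  pairs : Finset (E.FinPath × E.FinPath)
  start_eq : ∀ x ∈ pairs, x.1.start = x.2.start
  finish_eq : ∀ x ∈ pairs, x.1.finish = x.2.finish
  pos : ∀ x ∈ pairs, 0 < x.2.length

namespace CodingSet

section Unitary

variable [Fintype V] [Fintype Ed] {E : DiGraph V Ed} (J : CodingSet E)

/-- The element `u_J = ∑ S_μ S_ν^*`. -/
def u : Leavitt E := ∑ x ∈ J.pairs, Leavitt.path x.1 * star (Leavitt.path x.2)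

lemma u_commute (v : V) : Commute J.u (Leavitt.P v) := by
  classical
  refine Commute.sum_left _ _ _ fun x hx => ?_
  have hl : ∀ μ : E.FinPath, Leavitt.P v * Leavitt.path μ =
      if μ.start = v then Leavitt.path μ else 0 := fun μ => by
    split_ifs with hw
    · rw [Leavitt.path, ← mul_assoc, hw, Leavitt.P_idem]
    · rw [Leavitt.path, ← mul_assoc, Leavitt.P_orth (Ne.symm hw), zero_mul]
  have hr : ∀ μ : E.FinPath, star (Leavitt.path μ) * Leavitt.P v =
      if μ.start = v then star (Leavitt.path μ) else 0 := fun μ => by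
    have := congr(star $(hl μ))
    rw [star_mul, Leavitt.star_P] at this
    rw [this]; split_ifs <;> simp
  rw [Commute, SemiconjBy, mul_assoc, hr, ← mul_assoc, hl, J.start_eq x hx]
  split_ifs <;> simp

/-- The endomorphism `λ_u` of `C^*(E)`, for `u = u_J` unitary: it fixes every `p_v` and maps `s_e`
to `u s_e`, where `L_ℤ(E)` is mapped canonically to `C^*(E)`. -/
def lambda (hu : J.u ∈ unitary (Leavitt E)) : GraphCStar E →⋆ₐ[ℂ] GraphCStar E :=
  GraphCStar.lambda (GraphCStar.univ.ofLeavitt J.u)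
    (by
      rw [Unitary.mem_iff] at hu ⊢
      rw [← CKFamily.ofLeavitt_star, ← map_mul, ← map_mul, hu.1, hu.2, map_one]
      exact ⟨rfl, rfl⟩)
    (fun v => by
      have := (J.u_commute v).map (GraphCStar.univ (E := E)).ofLeavitt
      rwa [CKFamily.ofLeavitt_P] at this)

end Unitary

variable {E : DiGraph V Ed} (J : CodingSet E)

/-- The vertices of the coding graph are the elements of the given set of pairs. -/
abbrev Vertex : Type u := {x : E.FinPath × E.FinPath // x ∈ J.pairs}

variable {J}

/-- The path `μ` of a vertex `(μ, e κ)` of the coding graph. -/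
def Vertex.mu (x : J.Vertex) : E.FinPath := x.1.1

/-- The edge `e` of a vertex `(μ, e κ)` of the coding graph. -/
def Vertex.head (x : J.Vertex) : Ed :=
  x.1.2.edges.head (List.ne_nil_of_length_pos (J.pos x.1 x.2))

/-- The path `κ` of a vertex `(μ, e κ)` of the coding graph. -/
def Vertex.kappa (x : J.Vertex) : E.FinPath := x.1.2.tail

variable (J) [Fintype V] [Fintype Ed]

/-- The edges of the coding graph: there is one edge from `(μ₁, e₁ κ₁)` to `(μ₂, e₂ κ₂)` if
`S_{κ₁}^* S_{μ₂}` is nonzero in `L_ℤ(E)`, and none otherwise. -/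
def Edge : Type u :=
  {η : J.Vertex × J.Vertex // star (Leavitt.path η.1.kappa) * Leavitt.path η.2.mu ≠ 0}

instance : Finite J.Edge := inferInstanceAs (Finite {η : J.Vertex × J.Vertex //
  star (Leavitt.path η.1.kappa) * Leavitt.path η.2.mu ≠ 0})

/-- The coding graph `E_J`. -/
def graph : DiGraph J.Vertex J.Edge where
  src η := η.1.1
  tgt η := η.1.2

variable {J}

/-- The label `S_{κ₁}^* S_{μ₂}` of an edge. -/
def Edge.label (η : J.Edge) : Leavitt E :=
  star (Leavitt.path η.1.1.kappa) * Leavitt.path η.1.2.mu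

/-- The degree of an edge is `|α|` if its label is `S_α`, and `-|α|` if its label is `S_α^*`. This
includes degree `0` for the labels `S_v = P_v`. -/
def Edge.HasDegree (η : J.Edge) (d : ℤ) : Prop :=
  (∃ α : E.FinPath, η.label = Leavitt.path α ∧ d = α.length) ∨
    (∃ α : E.FinPath, η.label = star (Leavitt.path α) ∧ d = -α.length)

def Edge.IsNonneg (η : J.Edge) : Prop := ∃ d, η.HasDegree d ∧ 0 ≤ d

def Edge.IsNonpos (η : J.Edge) : Prop := ∃ d, η.HasDegree d ∧ d ≤ 0

/-- The label `𝓔(ω) = e₁ e₂ ⋯ e_k`: the edges `e` of all vertices `(μ, e κ)` that `ω` visits. -/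
def codeLabel (ω : J.graph.FinPath) : List Ed := ω.vertices.map Vertex.head

/-- The label `𝓔(ω) = e₁ e₂ ⋯` of an infinite path in the coding graph. -/
def codeLabelInf (ω : J.graph.InfPath) : ℕ → Ed := fun n => (J.graph.src (ω.1 n)).head

variable (J)

/-- Left-synchronization of the coding graph with its label `𝓔`. -/
def LeftSynchronizing : Prop :=
  ∃ m : ℕ, ∀ ω ω' : J.graph.FinPath, ω.length = m → ω'.length = m →
    codeLabel ω = codeLabel ω' → ω.start = ω'.start

/-- Some cycle of the coding graph consists of non-positive edges. -/
def HasNonposCycle : Prop :=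
  ∃ ω : J.graph.FinPath, ω.IsCycle ∧ ∀ η ∈ ω.edges, Edge.IsNonpos η

end CodingSet

/-! ## Transducers -/

/-- A transducer with finitely many states: from a state and an input letter, it passes to a new
state and writes a finite, possibly empty, word. The alphabets are meant to be finite. -/
structure Transducer (A B : Type u) where
  State : Type u
  finite : Finite State
  init : State
  step : State → A → State × List B

namespace Transducer

variable {A B C : Type u}

/-- The state after reading the first `n` letters of `α`. -/
def stateAt (T : Transducer A B) (α : ℕ → A) : ℕ → T.State
  | 0 => T.init
  | n + 1 => (T.step (T.stateAt α n) (α n)).1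

/-- The word written while reading the first `n` letters of `α`. -/
def outputUpTo (T : Transducer A B) (α : ℕ → A) : ℕ → List B
  | 0 => []
  | n + 1 => T.outputUpTo α n ++ (T.step (T.stateAt α n) (α n)).2

/-- `α[T]β`: the concatenation of all the words that `T` writes while it reads the infinite word
`α` is the infinite word `β`. -/
def Outputs (T : Transducer A B) (α : ℕ → A) (β : ℕ → B) : Prop :=
  (∀ (n i : ℕ) (h : i < (T.outputUpTo α n).length), (T.outputUpTo α n)[i] = β i) ∧
    ∀ k, ∃ n, k ≤ (T.outputUpTo α n).length

/-- Reading a finite word from a given state: the final state, and the word written. -/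
def run (T : Transducer A B) : T.State → List A → T.State × List B
  | q, [] => (q, [])
  | q, a :: w => ((T.run (T.step q a).1 w).1, (T.step q a).2 ++ (T.run (T.step q a).1 w).2)

/-- The composition of two transducers: the output of `T` is fed into `T'`. -/
def comp (T' : Transducer B C) (T : Transducer A B) : Transducer A C where
  State := T.State × T'.State
  finite := by
    have := T.finite
    have := T'.finite
    infer_instance
  init := (T.init, T'.init)
  step q a :=
    (((T.step q.1 a).1, (T'.run q.2 (T.step q.1 a).2).1), (T'.run q.2 (T.step q.1 a).2).2)

end Transducer

/-- A sliding block code between spaces of infinite paths: each letter of the image is computed by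
the same map from a window of fixed length. -/
def IsSlidingBlockCode {V' Ed' : Type u} {E : DiGraph V Ed} {E' : DiGraph V' Ed'}
    (Φ : E.InfPath → E'.InfPath) : Prop :=
  ∃ (N : ℕ) (φ : (Fin N → Ed) → Ed'),
    ∀ (α : E.InfPath) (n : ℕ), (Φ α).1 n = φ fun j => α.1 (n + j)

/-- The labelling transducer, for a choice of a path `γ η` for each edge `η` of the coding graph. It
remembers the last edge that it has read. On the first edge `ω₁` it writes the path `μ` of the
source `(μ, e κ)` of `ω₁`; on each edge `ω_{i+1}` it writes `γ ω_i`. -/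
def CodingSet.labelling [Fintype V] [Fintype Ed] {E : DiGraph V Ed} (J : CodingSet E)
    (γ : J.Edge → E.FinPath) : Transducer J.Edge Ed where
  State := Option J.Edge
  finite := inferInstance
  init := none
  step
    | none, η => (some η, (J.graph.src η).mu.edges)
    | some η, η' => (some η', (γ η).edges)

end

/-! Let `C^*(E)` act on `ℓ²(E^∞)` by `s_e δ_α = δ_{eα}`. Every `δ_α` is a common eigenvector of the
diagonal, and its eigenvalues form the character of `α`. Conversely, a character is `1` on exactly
one `p_μ` of each length, and these `μ` are the initial segments of a single infinite path
(`pathSpectrum`).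

In this representation unitarity of `u` becomes combinatorial: every infinite path has exactly one
`μ` and exactly one `ν` from the pairs in `J` as an initial segment (`existsUnique_mu`,
`existsUnique_nu`). Hence `u^*` permutes the basis by `μβ ↦ νβ = eκβ` (`pre`); dropping `e` gives
the map `μβ ↦ κβ` (`next`). The recursion `λ_u(p_{eμ}) = u s_e λ_u(p_μ) s_e^* u^*` then shows that
`λ_u^*` sends `α` to `code α`, the sequence of edges `e` met along the iterates of `next`
(`vecState_lambda_rp`). The pairs met on the way form an infinite path in `E_J`, the itinerary of
`α`, and its `𝓔`-label is `code α`.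

To invert `code`, left-synchronization recovers each vertex of the itinerary from a window of the
label. The itinerary in turn gives back `α`: if the `n`-th iterate is `μ_n β_n`, then `κ_n β_n =
μ_{n+1} β_{n+1}`, and since the edge label is some `S_{γ_n}`, this says `β_n = γ_n β_{n+1}`
(`label_isInitial`). So `α = μ_0 γ_0 γ_1 ⋯`, which is what the labelling transducer writes; the
output is infinite because labels that have length `0` from some point on would produce a cycle of
non-positive edges (`exists_pos_length`). Thus `code` is injective. It is surjective because its
image is compact and meets every cylinder set (`code_surjective`). Gelfand duality makes `λ_u` an
automorphism of the diagonal, and `ψ_u`, the inverse of `code`, is the labelling transducer applied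
to the sliding block code `α ↦ itinerary of ψ_u(α)`. -/

noncomputable section

/-! ### Finite and infinite paths, prefixes and concatenation. -/

namespace DiGraph

variable {V Ed : Type u} {E : DiGraph V Ed}

namespace FinPath

/-- The path of length `0` at `v`. -/
def nil (v : V) : E.FinPath := ⟨v, [], trivial⟩

/-- The path `e μ`. -/
def cons (e : Ed) (μ : E.FinPath) (h : E.tgt e = μ.start) : E.FinPath :=
  ⟨E.src e, e :: μ.edges, rfl, h ▸ μ.isPath⟩

@[elab_as_elim]
theorem induction {motive : E.FinPath → Prop} (nil : ∀ v, motive (nil v))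
    (cons : ∀ e μ h, motive μ → motive (cons e μ h)) (μ : E.FinPath) : motive μ := by
  obtain ⟨v, l, hl⟩ := μ
  induction l generalizing v with
  | nil => exact nil v
  | cons e l ih =>
    obtain ⟨rfl, h⟩ := hl
    exact cons e ⟨E.tgt e, l, h⟩ rfl (ih _ h)

lemma finish_cons (e : Ed) (μ : E.FinPath) (h : E.tgt e = μ.start) :
    (cons e μ h).finish = μ.finish := by
  simp [finish, cons, endFrom, h]

lemma length_cons (e : Ed) (μ : E.FinPath) (h : E.tgt e = μ.start) :
    (cons e μ h).length = μ.length + 1 := rfl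

/-- The path `μ e`. -/
def snoc (μ : E.FinPath) (e : Ed) (h : μ.finish = E.src e) : E.FinPath :=
  ⟨μ.start, μ.edges ++ [e], by
    induction μ using induction with
    | nil v => exact ⟨h.symm, trivial⟩
    | cons f μ hf ih => exact ⟨rfl, hf ▸ ih ((finish_cons f μ hf).symm.trans h)⟩⟩

lemma finish_snoc (μ : E.FinPath) (e : Ed) (h : μ.finish = E.src e) :
    (μ.snoc e h).finish = E.tgt e := by
  induction μ using induction with
  | nil v => rfl
  | cons f μ hf ih =>
    have h' := (finish_cons f μ hf).symm.trans h
    exact (finish_cons f (μ.snoc e h') hf).trans (ih h')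

lemma cons_tail_head (μ : E.FinPath) (h : 0 < μ.length) :
    ∃ h', μ = cons (μ.edges.head (List.ne_nil_of_length_pos h)) μ.tail h' := by
  obtain ⟨v, _ | ⟨e, l⟩, hl⟩ := μ
  · simp [length] at h
  · obtain ⟨rfl, hl⟩ := hl
    exact ⟨rfl, rfl⟩

end FinPath

namespace InfPath

/-- The infinite path without its first `k` edges. -/
def drop (k : ℕ) (α : E.InfPath) : E.InfPath :=
  ⟨fun n => α.1 (n + k), fun n => by rw [α.2, Nat.add_right_comm]⟩

/-- The infinite path `e α`. -/
def cons (e : Ed) (α : E.InfPath) (h : E.tgt e = E.src (α.1 0)) : E.InfPath :=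
  ⟨fun n => Nat.casesOn n e α.1, fun n => by cases n with
    | zero => exact h
    | succ n => exact α.2 n⟩

lemma ext {α β : E.InfPath} (h : ∀ n, α.1 n = β.1 n) : α = β := Subtype.ext (funext h)

@[simp] lemma cons_zero (e : Ed) (α : E.InfPath) (h) : (cons e α h).1 0 = e := rfl

@[simp] lemma cons_succ (e : Ed) (α : E.InfPath) (h) (n : ℕ) :
    (cons e α h).1 (n + 1) = α.1 n := rfl

@[simp] lemma drop_cons (e : Ed) (α : E.InfPath) (h) : (cons e α h).drop 1 = α := rfl

@[simp] lemma drop_zero (α : E.InfPath) : α.drop 0 = α := rfl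

lemma drop_drop (α : E.InfPath) (k l : ℕ) : (α.drop k).drop l = α.drop (l + k) :=
  ext fun n => by simp [drop, add_assoc]

lemma tgt_zero (α : E.InfPath) : E.tgt (α.1 0) = E.src ((α.drop 1).1 0) := α.2 0

lemma cons_drop (α : E.InfPath) : cons (α.1 0) (α.drop 1) α.tgt_zero = α :=
  ext fun n => by cases n <;> rfl

/-- The segment of `α` of length `m` that starts with the edge number `n`. -/
def take (α : E.InfPath) (n m : ℕ) : E.FinPath :=
  ⟨E.src (α.1 n), (List.range' n m).map α.1, by
    induction m generalizing n with
    | zero => trivial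
    | succ m ih => exact ⟨rfl, α.2 n ▸ ih (n + 1)⟩⟩

lemma take_succ (α : E.InfPath) (n m : ℕ) :
    α.take n (m + 1) = FinPath.cons (α.1 n) (α.take (n + 1) m) (α.2 n) := rfl

lemma finish_take (α : E.InfPath) (n m : ℕ) : (α.take n m).finish = E.src (α.1 (n + m)) := by
  induction m generalizing n with
  | zero => rfl
  | succ m ih =>
    refine (FinPath.finish_cons _ _ (α.2 n)).trans ((ih (n + 1)).trans ?_)
    rw [Nat.add_right_comm, Nat.add_assoc]

lemma vertices_take (α : E.InfPath) (n m : ℕ) :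
    (α.take n m).vertices = (List.range' n (m + 1)).map fun i => E.src (α.1 i) := by
  induction m generalizing n with
  | zero => rfl
  | succ m ih =>
    have := ih (n + 1)
    simp only [FinPath.vertices, take_succ, FinPath.cons, List.map_cons] at this ⊢
    rw [List.range'_succ, List.map_cons, ← this, α.2]
    rfl

lemma length_take (α : E.InfPath) (n m : ℕ) : (α.take n m).length = m := by
  simp [take, FinPath.length]

end InfPath

namespace FinPath

lemma isInitial_nil {v : V} {α : E.InfPath} : (nil v).IsInitial α ↔ E.src (α.1 0) = v := by
  simp [IsInitial, nil]

lemma isInitial_cons {e : Ed} {μ : E.FinPath} {h : E.tgt e = μ.start} {α : E.InfPath} :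
    (cons e μ h).IsInitial α ↔ α.1 0 = e ∧ μ.IsInitial (α.drop 1) := by
  constructor
  · rintro ⟨-, h2⟩
    have h0 : e = α.1 0 := h2 0 (by simp [cons])
    refine ⟨h0.symm, ?_, fun i hi => ?_⟩
    · rw [← h, h0, α.tgt_zero]
    · exact h2 (i + 1) (by simpa [cons] using hi)
  · rintro ⟨rfl, h1, h2⟩
    refine ⟨rfl, fun i hi => ?_⟩
    cases i with
    | zero => rfl
    | succ i => exact h2 i (by simpa [cons] using hi)

lemma exists_isInitial (μ : E.FinPath) (β : E.InfPath) (h : E.src (β.1 0) = μ.finish) :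
    ∃ α : E.InfPath, μ.IsInitial α ∧ α.drop μ.length = β := by
  induction μ using induction with
  | nil v => exact ⟨β, isInitial_nil.2 h, rfl⟩
  | cons e μ hμ ih =>
    obtain ⟨α, h1, h2⟩ := ih (by rw [h, finish_cons])
    refine ⟨.cons e α (hμ.trans h1.1.symm), isInitial_cons.2 ⟨rfl, h1⟩, ?_⟩
    rw [length_cons, ← InfPath.drop_drop _ 1, InfPath.drop_cons, h2]

lemma IsInitial.src_drop {μ : E.FinPath} {α : E.InfPath} (h : μ.IsInitial α) :
    E.src ((α.drop μ.length).1 0) = μ.finish := by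
  induction μ using induction generalizing α with
  | nil v => exact h.1
  | cons e μ hμ ih =>
    rw [length_cons, ← InfPath.drop_drop _ 1, ih (isInitial_cons.1 h).2, finish_cons]

/-- Streams are used because concatenation with them is associative; the output `μ_0 γ_0 γ_1 ⋯` of
the labelling transducer is assembled from this form. -/
lemma IsInitial.appendStream {μ : E.FinPath} {α : E.InfPath} (h : μ.IsInitial α) :
    (α.1 : Stream' Ed) = Stream'.appendStream' μ.edges (α.drop μ.length).1 := by
  induction μ using induction generalizing α with
  | nil v => rfl
  | cons e μ hμ ih =>
    obtain ⟨h1, h2⟩ := isInitial_cons.1 h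
    have h3 := ih h2
    rw [length_cons, ← InfPath.drop_drop _ 1]
    change _ = Stream'.cons e (Stream'.appendStream' μ.edges _)
    rw [← h3]
    funext n
    cases n with
    | zero => exact h1
    | succ n => rfl

lemma IsInitial.eq {μ : E.FinPath} {α β : E.InfPath} (hα : μ.IsInitial α) (hβ : μ.IsInitial β)
    (h : α.drop μ.length = β.drop μ.length) : α = β :=
  Subtype.ext (hα.appendStream.trans (h ▸ hβ.appendStream.symm))

lemma isInitial_take (α : E.InfPath) (m : ℕ) : (α.take 0 m).IsInitial α := by
  refine ⟨rfl, fun i hi => ?_⟩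
  simp [InfPath.take]

lemma IsInitial.eq_take {μ : E.FinPath} {α : E.InfPath} (h : μ.IsInitial α) :
    μ = α.take 0 μ.length := by
  refine FinPath.ext h.1.symm (List.ext_getElem ?_ fun i h1 h2 => ?_)
  · simp [InfPath.take, length]
  · simp [InfPath.take, h.2 i h1]

end FinPath

lemma NoSinks.exists_infPath (h : E.NoSinks) (v : V) : ∃ α : E.InfPath, E.src (α.1 0) = v := by
  choose f hf using h
  let a : ℕ → Ed := fun n => Nat.rec (f v) (fun _ e => f (E.tgt e)) n
  exact ⟨⟨a, fun n => (hf _).symm⟩, hf v⟩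

end DiGraph

open DiGraph

variable {V Ed : Type u} [Fintype V] [Fintype Ed] {E : DiGraph V Ed}

/-! ### Path elements and range projections in a Cuntz–Krieger family. -/

namespace CKFamily

variable {A : Type*} [CStarAlgebra A] (F : CKFamily E A)

lemma ofLeavitt_path (μ : E.FinPath) : F.ofLeavitt (Leavitt.path μ) = F.path μ := by
  rw [Leavitt.path, path, map_mul, ofLeavitt_P, map_list_prod, List.map_map]
  congr 3
  funext e
  exact F.ofLeavitt_S e

lemma star_p (v : V) : star (F.p v) = F.p v := (F.proj v).isSelfAdjoint

lemma p_mul_p (v : V) : F.p v * F.p v = F.p v := (F.proj v).isIdempotentElem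

lemma path_nil (v : V) : F.path (FinPath.nil v) = F.p v := by
  simp [path, FinPath.nil]

lemma path_cons (e : Ed) (μ : E.FinPath) (h : E.tgt e = μ.start) :
    F.path (FinPath.cons e μ h) = F.s e * F.path μ := by
  simp [path, FinPath.cons, ← mul_assoc, F.p_mul_s, ← h, F.s_mul_p]

lemma p_mul_path (μ : E.FinPath) : F.p μ.start * F.path μ = F.path μ := by
  rw [path, ← mul_assoc, F.p_mul_p]

lemma p_mul_path_of_ne {v : V} {μ : E.FinPath} (h : v ≠ μ.start) : F.p v * F.path μ = 0 := by
  rw [path, ← mul_assoc, F.orth _ _ h, zero_mul]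

/-- The range projection `s_μ s_μ^*`. -/
def rp (μ : E.FinPath) : A := F.path μ * star (F.path μ)

lemma star_rp (μ : E.FinPath) : star (F.rp μ) = F.rp μ := by simp [rp]

lemma rp_nil (v : V) : F.rp (FinPath.nil v) = F.p v := by
  rw [rp, path_nil, star_p, p_mul_p]

lemma rp_cons (e : Ed) (μ : E.FinPath) (h : E.tgt e = μ.start) :
    F.rp (FinPath.cons e μ h) = F.s e * F.rp μ * star (F.s e) := by
  simp [rp, path_cons, mul_assoc]

lemma p_mul_rp (μ : E.FinPath) : F.p μ.start * F.rp μ = F.rp μ := by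
  rw [rp, ← mul_assoc, p_mul_path]

lemma p_mul_rp_of_ne {v : V} {μ : E.FinPath} (h : v ≠ μ.start) : F.p v * F.rp μ = 0 := by
  rw [rp, ← mul_assoc, p_mul_path_of_ne _ h, zero_mul]

lemma rp_mul_p (μ : E.FinPath) : F.rp μ * F.p μ.start = F.rp μ := by
  simpa [star_p, star_rp] using congr(star $(F.p_mul_rp μ))

lemma rp_mul_p_of_ne {v : V} {μ : E.FinPath} (h : v ≠ μ.start) : F.rp μ * F.p v = 0 := by
  simpa [star_p, star_rp] using congr(star $(F.p_mul_rp_of_ne h))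

lemma star_path_mul_path (μ : E.FinPath) : star (F.path μ) * F.path μ = F.p μ.finish := by
  induction μ using FinPath.induction with
  | nil v => rw [path_nil, star_p, p_mul_p]; rfl
  | cons e μ h ih =>
    rw [path_cons, star_mul, mul_assoc, ← mul_assoc (star (F.s e)), gca1, h, p_mul_path, ih,
      FinPath.finish_cons]

lemma path_mul_p (μ : E.FinPath) : F.path μ * F.p μ.finish = F.path μ := by
  induction μ using FinPath.induction with
  | nil v => rw [path_nil]; exact F.p_mul_p v
  | cons e μ h ih => rw [path_cons, FinPath.finish_cons, mul_assoc, ih]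

lemma rp_mul_path (μ : E.FinPath) : F.rp μ * F.path μ = F.path μ := by
  rw [rp, mul_assoc, star_path_mul_path, path_mul_p]

lemma star_s_mul_rp_mul_s (e : Ed) (μ : E.FinPath) :
    (∃ ν : E.FinPath, star (F.s e) * F.rp μ * F.s e = F.rp ν) ∨
      star (F.s e) * F.rp μ * F.s e = 0 := by
  induction μ using FinPath.induction with
  | nil v =>
    rw [rp_nil]
    by_cases h : v = E.src e
    · subst h
      exact .inl ⟨FinPath.nil (E.tgt e), by rw [mul_assoc, p_mul_s, gca1, rp_nil]⟩
    · right
      rw [← F.p_mul_s e, mul_assoc, ← mul_assoc (F.p v), F.orth _ _ h, zero_mul, mul_zero]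
  | cons f μ h =>
    rw [rp_cons]
    by_cases hf : e = f
    · subst hf
      refine .inl ⟨μ, ?_⟩
      simp only [mul_assoc]
      rw [gca1, ← mul_assoc, gca1, h, rp_mul_p, p_mul_rp]
    · right
      simp only [← mul_assoc]
      rw [F.star_s_mul_s hf]; simp

lemma s_mul_rp_mul_star_s (e : Ed) (μ : E.FinPath) :
    (∃ ν : E.FinPath, F.s e * F.rp μ * star (F.s e) = F.rp ν) ∨
      F.s e * F.rp μ * star (F.s e) = 0 := by
  by_cases h : E.tgt e = μ.start
  · exact .inl ⟨_, (F.rp_cons e μ h).symm⟩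
  · right
    rw [← F.s_mul_p e, mul_assoc (F.s e), F.p_mul_rp_of_ne h]; simp

/-- Two paths are either comparable, and then the longer one has the smaller projection, or they
differ at some edge or in the source, and then the projections are orthogonal. The induction strips
common first edges. This is what makes the linear span of the `p_μ` an algebra. -/
lemma rp_mul_rp (μ ν : E.FinPath) :
    F.rp μ * F.rp ν = F.rp μ ∨ F.rp μ * F.rp ν = F.rp ν ∨ F.rp μ * F.rp ν = 0 := by
  induction μ using FinPath.induction generalizing ν with
  | nil v =>
    rw [rp_nil]
    by_cases h : v = ν.start
    · subst h; exact .inr (.inl (F.p_mul_rp ν))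
    · exact .inr (.inr (F.p_mul_rp_of_ne h))
  | cons e μ h ih =>
    induction ν using FinPath.induction with
    | nil v =>
      rw [rp_nil]
      by_cases hv : v = E.src e
      · subst hv; exact .inl (F.rp_mul_p (FinPath.cons e μ h))
      · exact .inr (.inr (F.rp_mul_p_of_ne (μ := FinPath.cons e μ h) hv))
    | cons f ν h' =>
      rw [rp_cons, rp_cons]
      by_cases hf : e = f
      · subst hf
        have key : F.s e * F.rp μ * star (F.s e) * (F.s e * F.rp ν * star (F.s e)) =
            F.s e * (F.rp μ * F.rp ν) * star (F.s e) := by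
          simp only [mul_assoc]
          rw [← mul_assoc (star (F.s e)) (F.s e), gca1, h, ← mul_assoc (F.rp μ) (F.p _), rp_mul_p]
        rw [key]
        rcases ih ν with h1 | h1 | h1 <;> rw [h1] <;> simp
      · right; right
        simp only [mul_assoc]
        rw [← mul_assoc (star (F.s e)) (F.s f), F.star_s_mul_s hf]; simp

/-- Distinct paths of equal length are never comparable. It follows that a character is nonzero on
at most one `p_μ` of each length. -/
lemma rp_mul_rp_of_ne {μ ν : E.FinPath} (hl : μ.length = ν.length) (hne : μ ≠ ν) :
    F.rp μ * F.rp ν = 0 := by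
  induction μ using FinPath.induction generalizing ν with
  | nil v =>
    rw [rp_nil]
    refine F.p_mul_rp_of_ne fun hv => hne ?_
    exact FinPath.ext hv (List.length_eq_zero_iff.1 hl.symm).symm
  | cons e μ h ih =>
    induction ν using FinPath.induction with
    | nil v => simp [FinPath.nil, FinPath.cons, FinPath.length] at hl
    | cons f ν h' =>
      rw [rp_cons, rp_cons]
      simp only [mul_assoc]
      by_cases hf : e = f
      · subst hf
        have hμν : μ ≠ ν := by rintro rfl; exact hne rfl
        rw [← mul_assoc (star (F.s e)) (F.s e), gca1, h, ← mul_assoc (F.rp μ) (F.p _), rp_mul_p,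
          ← mul_assoc (F.rp μ), ih (by simpa [FinPath.length_cons] using hl) hμν]
        simp
      · rw [← mul_assoc (star (F.s e)) (F.s f), F.star_s_mul_s hf]; simp

lemma path_snoc (μ : E.FinPath) (e : Ed) (h : μ.finish = E.src e) :
    F.path (μ.snoc e h) = F.path μ * F.s e := by
  simp [path, FinPath.snoc, mul_assoc]

open Classical in
-- Inserting `p_{r(μ)} = ∑ s_e s_e^*` between `s_μ` and `s_μ^*` splits `p_μ` into the `p_{μe}`.
lemma rp_eq_sum (μ : E.FinPath) : F.rp μ =
    ∑ e with E.src e = μ.finish, F.path μ * F.s e * star (F.path μ * F.s e) := by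
  rw [rp]
  nth_rw 1 [← F.path_mul_p]
  rw [F.gca2, Finset.mul_sum, Finset.sum_mul]
  exact Finset.sum_congr rfl fun e _ => by simp [mul_assoc]

/-- The product is again some `p` or `0`, hence self-adjoint. -/
lemma rp_comm (μ ν : E.FinPath) : F.rp μ * F.rp ν = F.rp ν * F.rp μ := by
  have h : star (F.rp μ * F.rp ν) = F.rp μ * F.rp ν := by
    rcases F.rp_mul_rp μ ν with h | h | h <;> rw [h] <;> simp [star_rp]
  rw [← h, star_mul, star_rp, star_rp]

end CKFamily

/-! ### The diagonal as a commutative algebra, and conjugations that preserve it. -/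

namespace GraphCStar

lemma rangeProj_coe (μ : E.FinPath) :
    ((rangeProj μ : diagonal E) : GraphCStar E) = univ.rp μ := rfl

lemma diagonal_subset_closure_span :
    (diagonal E : Set (GraphCStar E)) ⊆
      closure (Submodule.span ℂ (Set.range (univ (E := E)).rp) : Set (GraphCStar E)) := by
  refine closure_mono ?_
  intro x hx
  let M := Submodule.span ℂ (Set.range (univ (E := E)).rp)
  have hmul : ∀ x ∈ M, ∀ y ∈ M, x * y ∈ M := by
    intro x hx y hy
    have : x * y ∈ M * M := Submodule.mul_mem_mul hx hy
    rw [Submodule.span_mul_span] at this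
    refine Submodule.span_le.2 ?_ this
    rintro _ ⟨_, ⟨μ, rfl⟩, _, ⟨ν, rfl⟩, rfl⟩
    rcases univ.rp_mul_rp μ ν with h | h | h <;> simp only [SetLike.mem_coe, h]
    · exact Submodule.subset_span ⟨μ, rfl⟩
    · exact Submodule.subset_span ⟨ν, rfl⟩
    · exact zero_mem _
  change x ∈ StarAlgebra.adjoin ℂ (Set.range (univ (E := E)).rp) at hx
  change x ∈ M
  induction hx using StarAlgebra.adjoin_induction with
  | mem x hx => exact Submodule.subset_span hx
  | algebraMap r =>
    rw [Algebra.algebraMap_eq_smul_one, ← univ.unit]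
    refine M.smul_mem _ (M.sum_mem fun v _ => Submodule.subset_span ⟨FinPath.nil v, univ.rp_nil v⟩)
  | add x y _ _ hx hy => exact add_mem hx hy
  | mul x y _ _ hx hy => exact hmul x hx y hy
  | star x _ hx =>
    change x ∈ M at hx
    change star x ∈ M
    clear * - hx
    induction hx using Submodule.span_induction with
    | mem x hx =>
      obtain ⟨μ, rfl⟩ := hx
      rw [univ.star_rp]; exact Submodule.subset_span ⟨μ, rfl⟩
    | zero => simp
    | add x y _ _ hx hy => rw [star_add]; exact add_mem hx hy
    | smul a x _ hx => rw [star_smul]; exact M.smul_mem _ hx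

/-- A closed linear subspace that contains all `p_μ` contains the diagonal. -/
lemma diagonal_le {M : Submodule ℂ (GraphCStar E)} (hM : IsClosed (M : Set (GraphCStar E)))
    (h : ∀ μ, univ.rp μ ∈ M) {x : GraphCStar E} (hx : x ∈ diagonal E) : x ∈ M :=
  closure_minimal (Submodule.span_le.2 (by rintro _ ⟨μ, rfl⟩; exact h μ)) hM
    (diagonal_subset_closure_span hx)

lemma rp_mem (μ : E.FinPath) : univ.rp μ ∈ diagonal E := (rangeProj μ).2

/-- Continuous linear maps that agree on all `p_μ` agree on the diagonal. -/
lemma eqOn_diagonal {B : Type*} [AddCommGroup B] [Module ℂ B] [TopologicalSpace B] [T2Space B]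
    {f g : GraphCStar E →ₗ[ℂ] B} (hf : Continuous f) (hg : Continuous g)
    (h : ∀ μ, f (univ.rp μ) = g (univ.rp μ)) {x : GraphCStar E} (hx : x ∈ diagonal E) :
    f x = g x :=
  diagonal_le (M := LinearMap.eqLocus f g) (isClosed_eq hf hg) h hx

/-- For maps such as characters, which are defined on the diagonal only. The set where they agree is
closed in the diagonal, hence closed in `C^*(E)`, so that `diagonal_le` applies to its image. -/
lemma diagonal_linearMap_ext {B : Type*} [AddCommGroup B] [Module ℂ B] [TopologicalSpace B]
    [T2Space B] {f g : diagonal E →ₗ[ℂ] B} (hf : Continuous f) (hg : Continuous g)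
    (h : ∀ μ, f (rangeProj μ) = g (rangeProj μ)) : f = g := by
  let D := (diagonal E).toSubalgebra.toSubmodule
  let f' : D →ₗ[ℂ] B := f
  let g' : D →ₗ[ℂ] B := g
  have hD : IsClosed (diagonal E : Set (GraphCStar E)) := inferInstance
  have hc : IsClosed ((LinearMap.eqLocus f' g').map D.subtype : Set (GraphCStar E)) :=
    hD.isClosedEmbedding_subtypeVal.isClosedMap _ (isClosed_eq hf hg)
  ext x
  obtain ⟨y, hy, hyx⟩ := diagonal_le hc (fun μ => ⟨rangeProj μ, h μ, rfl⟩) x.2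
  obtain rfl : y = x := Subtype.ext hyx
  exact hy

/-- A continuous linear map that maps all `p_μ` into the diagonal preserves the diagonal. -/
lemma map_mem_diagonal {f : GraphCStar E →ₗ[ℂ] GraphCStar E} (hf : Continuous f)
    (h : ∀ μ, f (univ.rp μ) ∈ diagonal E) {x : GraphCStar E} (hx : x ∈ diagonal E) :
    f x ∈ diagonal E :=
  diagonal_le (M := (diagonal E).toSubalgebra.toSubmodule.comap f)
    ((inferInstance : IsClosed (diagonal E : Set (GraphCStar E))).preimage hf) h hx

/-- The map `x ↦ a x b`. -/
def mulLR (a b : GraphCStar E) : GraphCStar E →ₗ[ℂ] GraphCStar E :=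
  LinearMap.mulLeft ℂ a ∘ₗ LinearMap.mulRight ℂ b

lemma mulLR_apply (a b x : GraphCStar E) : mulLR a b x = a * x * b := by
  simp [mulLR, mul_assoc]

lemma continuous_mulLR (a b : GraphCStar E) : Continuous (mulLR a b) := by
  simp only [mulLR, LinearMap.coe_comp]
  exact (continuous_const.mul continuous_id).comp (continuous_id.mul continuous_const)

lemma conj_s_mem (e : Ed) {x : GraphCStar E} (hx : x ∈ diagonal E) :
    univ.s e * x * star (univ.s e) ∈ diagonal E := by
  rw [← mulLR_apply]
  refine map_mem_diagonal (continuous_mulLR _ _) (fun μ => ?_) hx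
  rw [mulLR_apply]
  rcases univ.s_mul_rp_mul_star_s e μ with ⟨ν, h⟩ | h <;> rw [h]
  exacts [rp_mem ν, zero_mem _]

lemma conj_star_s_mem (e : Ed) {x : GraphCStar E} (hx : x ∈ diagonal E) :
    star (univ.s e) * x * univ.s e ∈ diagonal E := by
  rw [← mulLR_apply]
  refine map_mem_diagonal (continuous_mulLR _ _) (fun μ => ?_) hx
  rw [mulLR_apply]
  rcases univ.star_s_mul_rp_mul_s e μ with ⟨ν, h⟩ | h <;> rw [h]
  exacts [rp_mem ν, zero_mem _]

lemma p_mem_diagonal (v : V) : (univ (E := E)).p v ∈ diagonal E := by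
  rw [← univ.rp_nil]; exact rp_mem _

lemma conj_path_mem (μ : E.FinPath) {x : GraphCStar E} (hx : x ∈ diagonal E) :
    univ.path μ * x * star (univ.path μ) ∈ diagonal E := by
  induction μ using FinPath.induction with
  | nil v =>
    rw [univ.path_nil, univ.star_p]
    exact mul_mem (mul_mem (p_mem_diagonal v) hx) (p_mem_diagonal v)
  | cons e μ h ih =>
    rw [univ.path_cons]
    simpa [mul_assoc] using conj_s_mem e ih

lemma conj_star_path_mem (μ : E.FinPath) {x : GraphCStar E} (hx : x ∈ diagonal E) :
    star (univ.path μ) * x * univ.path μ ∈ diagonal E := by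
  induction μ using FinPath.induction generalizing x with
  | nil v =>
    rw [univ.path_nil, univ.star_p]
    exact mul_mem (mul_mem (p_mem_diagonal v) hx) (p_mem_diagonal v)
  | cons e μ h ih =>
    rw [univ.path_cons]
    simpa [mul_assoc] using ih (conj_star_s_mem e hx)

/-- The commutation of the `p_μ` is extended by density in one variable at a time. -/
lemma diagonal_commute {x y : GraphCStar E} (hx : x ∈ diagonal E) (hy : y ∈ diagonal E) :
    x * y = y * x := by
  refine eqOn_diagonal (f := LinearMap.mulRight ℂ y) (g := LinearMap.mulLeft ℂ y)
    (continuous_id.mul continuous_const) (continuous_const.mul continuous_id) (fun μ => ?_) hx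
  refine eqOn_diagonal (f := LinearMap.mulLeft ℂ (univ.rp μ)) (g := LinearMap.mulRight ℂ _)
    (continuous_const.mul continuous_id) (continuous_id.mul continuous_const) (fun ν => ?_) hy
  exact univ.rp_comm μ ν

/-- The diagonal as a commutative C*-algebra. -/
abbrev diagonalCommCStarAlgebra : CommCStarAlgebra (diagonal E) where
  mul_comm x y := Subtype.ext (diagonal_commute x.2 y.2)

end GraphCStar
end

noncomputable section

/-! ## Partial bijections as operators on `ℓ²` -/

namespace PEquiv

open scoped InnerProductSpace

variable {X : Type*}

lemma sum_elim_rpow_le (f : X ≃. X) (φ : lp (fun _ : X => ℂ) 2) (s : Finset X) :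
    ∑ x ∈ s, ‖(f x).elim 0 φ‖ ^ (2 : ℝ≥0∞).toReal ≤ ‖φ‖ ^ (2 : ℝ≥0∞).toReal := by
  classical
  -- The value at points where `f` is undefined is arbitrary. On the domain `k` is injective, so the
  -- sum runs over distinct coordinates of `φ`.
  let k : X → X := fun x => (f x).getD x
  have h1 : ∑ x ∈ s, ‖(f x).elim 0 φ‖ ^ (2 : ℝ≥0∞).toReal =
      ∑ x ∈ s with (f x).isSome, ‖φ (k x)‖ ^ (2 : ℝ≥0∞).toReal := by
    rw [Finset.sum_filter]
    refine Finset.sum_congr rfl fun x _ => ?_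
    cases h : f x <;> simp [k, h]
  rw [h1, ← Finset.sum_image (f := fun y => ‖φ y‖ ^ (2 : ℝ≥0∞).toReal) (g := k)]
  · exact lp.sum_rpow_le_norm_rpow (by simp) φ _
  · intro x hx y hy hxy
    simp only [Finset.coe_filter, Set.mem_ofPred_eq, Option.isSome_iff_exists] at hx hy
    obtain ⟨-, a, ha⟩ := hx
    obtain ⟨-, b, hb⟩ := hy
    simp only [k, ha, hb, Option.getD_some] at hxy
    subst hxy
    exact f.inj (Option.mem_def.2 ha) (Option.mem_def.2 hb)

/-- The partial isometry on `ℓ²` that composes functions with a partial bijection. -/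
def toL2 (f : X ≃. X) : lp (fun _ : X => ℂ) 2 →L[ℂ] lp (fun _ : X => ℂ) 2 :=
  LinearMap.mkContinuous
    { toFun := fun φ => ⟨fun x => (f x).elim 0 φ, memℓp_gen' (f.sum_elim_rpow_le φ)⟩
      map_add' := fun φ ψ => by
        ext x
        change (f x).elim 0 (φ + ψ : lp (fun _ : X => ℂ) 2) = (f x).elim 0 φ + (f x).elim 0 ψ
        cases f x
        · exact (add_zero 0).symm
        · rfl
      map_smul' := fun c φ => by
        ext x
        change (f x).elim 0 (c • φ : lp (fun _ : X => ℂ) 2) = c • (f x).elim 0 φ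
        cases f x
        · exact (smul_zero c).symm
        · rfl }
    1 (fun φ => by
      rw [one_mul]
      exact lp.norm_le_of_forall_sum_le (by simp) (norm_nonneg _) (f.sum_elim_rpow_le φ))

lemma toL2_apply (f : X ≃. X) (φ : lp (fun _ : X => ℂ) 2) (x : X) :
    f.toL2 φ x = (f x).elim 0 φ := rfl

/-- The order is kept: pulling functions back reverses composition, and so does the left-to-right
convention of `trans`. -/
lemma toL2_trans (f g : X ≃. X) : (f.trans g).toL2 = f.toL2 * g.toL2 := by
  ext φ x
  change _ = f.toL2 (g.toL2 φ) x
  rw [toL2_apply, toL2_apply]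
  change ((f x).bind g).elim 0 φ = _
  cases f x <;> rfl

lemma toL2_bot : (⊥ : X ≃. X).toL2 = 0 := rfl

/-- The standard basis vector of `ℓ²`. -/
def delta (x : X) : lp (fun _ : X => ℂ) 2 := by
  classical exact lp.single 2 x 1

lemma inner_delta (x : X) (φ : lp (fun _ : X => ℂ) 2) : ⟪delta x, φ⟫_ℂ = φ x := by
  classical
  rw [delta, lp.inner_single_left]
  simp

open Classical in
lemma delta_apply (x y : X) : delta x y = if y = x then 1 else 0 := by
  rw [delta, lp.single_apply, Pi.single_apply]

lemma delta_injective : Function.Injective (delta (X := X)) := fun x y h => by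
  have := delta_apply x x
  rw [h, delta_apply] at this
  by_contra hxy
  simp [hxy] at this

lemma delta_ne_zero (x : X) : delta x ≠ 0 := fun h => by
  have := delta_apply x x
  rw [h] at this
  simp at this

lemma inner_delta_self (x : X) : ⟪delta x, delta x⟫_ℂ = 1 := by
  rw [inner_delta, delta_apply, if_pos rfl]

/-- Pulling back the indicator of `x` gives the indicator of its preimage, so basis vectors move
along the inverse. This is why `removeEdge e`, which deletes `e`, yields the operator `δ_α ↦
δ_{eα}`. -/
lemma toL2_delta (f : X ≃. X) (x : X) : f.toL2 (delta x) = (f.symm x).elim 0 delta := by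
  ext y
  rw [toL2_apply]
  cases h : f y with
  | none =>
    cases h' : f.symm x with
    | none => rfl
    | some z =>
      have hz := (eq_some_iff f).1 h'
      have hyz : y ≠ z := by rintro rfl; simp [h] at hz
      simp [delta_apply, hyz]
  | some w =>
    cases h' : f.symm x with
    | none =>
      have hwx : w ≠ x := by rintro rfl; simp [(eq_some_iff f).2 h] at h'
      simp [delta_apply, hwx]
    | some z =>
      have hz := (eq_some_iff f).1 h'
      have : w = x ↔ y = z := by
        constructor
        · rintro rfl; exact f.inj (Option.mem_def.2 h) (Option.mem_def.2 hz)
        · rintro rfl; simpa [h] using hz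
      change delta x w = delta z y
      rw [delta_apply, delta_apply]
      classical exact if_congr this rfl rfl

lemma sum_toL2_apply {ι : Type*} (s : Finset ι) (f : ι → X ≃. X) (φ : lp (fun _ : X => ℂ) 2)
    (x : X) : (∑ i ∈ s, (f i).toL2) φ x = ∑ i ∈ s, (f i).toL2 φ x := by
  rw [← inner_delta, sum_apply, inner_sum]
  exact Finset.sum_congr rfl fun i _ => inner_delta _ _

lemma star_toL2 (f : X ≃. X) : star f.toL2 = f.symm.toL2 := by
  ext φ x
  rw [← inner_delta x, ContinuousLinearMap.star_eq_adjoint, ContinuousLinearMap.adjoint_inner_right,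
    toL2_delta, toL2_apply]
  cases f.symm x with
  | none => simp
  | some y => exact inner_delta y φ

end PEquiv

instance {H : Type*} [NormedAddCommGroup H] [InnerProductSpace ℂ H] [CompleteSpace H] :
    CStarAlgebra (H →L[ℂ] H) where

variable {V Ed : Type u} {E : DiGraph V Ed}

/-! ## The representation on `ℓ²(E^∞)` -/

namespace DiGraph.InfPath

open Classical in
/-- The partial bijection `e α ↦ α`. -/
def removeEdge (e : Ed) : E.InfPath ≃. E.InfPath where
  toFun α := if α.1 0 = e then some (α.drop 1) else none
  invFun β := if h : E.tgt e = E.src (β.1 0) then some (cons e β h) else none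
  inv α β := by
    simp only [Option.dite_none_right_eq_some, Option.ite_none_right_eq_some,
      Option.some.injEq]
    constructor
    · rintro ⟨h, rfl⟩
      exact ⟨rfl, rfl⟩
    · rintro ⟨rfl, rfl⟩
      exact ⟨α.tgt_zero, α.cons_drop⟩

open Classical in
lemma removeEdge_apply (e : Ed) (α : E.InfPath) :
    removeEdge e α = if α.1 0 = e then some (α.drop 1) else none := rfl

open Classical in
lemma removeEdge_symm_apply (e : Ed) (β : E.InfPath) :
    (removeEdge e).symm β = if h : E.tgt e = E.src (β.1 0) then some (cons e β h) else none := rfl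

open Classical in
/-- The identity on the set of paths that start at `v`. -/
def atVertex (v : V) : E.InfPath ≃. E.InfPath := PEquiv.ofSet {α | E.src (α.1 0) = v}

open Classical in
lemma atVertex_apply (v : V) (α : E.InfPath) :
    atVertex v α = if E.src (α.1 0) = v then some α else none := rfl

lemma continuous_of_isOpen {Y : Type*} [TopologicalSpace Y] {f : Y → E.InfPath}
    (h : ∀ n e, IsOpen {y | (f y).1 n = e}) : Continuous f := by
  let _ : TopologicalSpace Ed := ⊥
  have : DiscreteTopology Ed := ⟨rfl⟩
  refine continuous_induced_rng.2 (continuous_pi fun n => ?_)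
  exact continuous_discrete_rng.2 fun e => h n e

instance : T2Space E.InfPath := by
  let _ : TopologicalSpace Ed := ⊥
  have : DiscreteTopology Ed := ⟨rfl⟩
  exact T2Space.of_injective_continuous Subtype.val_injective continuous_induced_dom

end DiGraph.InfPath

open DiGraph InfPath PEquiv

variable [Fintype V] [Fintype Ed]

/-- The representation of the graph algebra on `ℓ²(E^∞)` in which `s_e` maps `α` to `e α`. -/
def CKFamily.l2 : CKFamily E (lp (fun _ : E.InfPath => ℂ) 2 →L[ℂ] lp (fun _ : E.InfPath => ℂ) 2) where
  p v := (atVertex v).toL2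
  s e := (removeEdge e).toL2
  proj v := by
    constructor
    · rw [IsIdempotentElem, ← toL2_trans]
      congr 1
      refine PEquiv.ext fun α => ?_
      change (atVertex v α).bind _ = _
      rw [atVertex_apply]
      split_ifs with h
      · simp [atVertex_apply, h]
      · rfl
    · rw [IsSelfAdjoint, star_toL2]; rfl
  orth v w h := by
    rw [← toL2_trans, ← toL2_bot]
    congr 1
    refine PEquiv.ext fun α => ?_
    change (atVertex v α).bind _ = none
    rw [atVertex_apply]
    split_ifs with h1
    · simpa [atVertex_apply, h1] using h
    · rfl
  gca1 e := by
    rw [star_toL2, ← toL2_trans]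
    congr 1
    refine PEquiv.ext fun α => ?_
    change ((removeEdge e).symm α).bind _ = _
    rw [atVertex_apply, removeEdge_symm_apply]
    split_ifs with h1 h2 h2
    · simp [removeEdge_apply]
    · exact absurd h1.symm h2
    · exact absurd h2.symm h1
    · rfl
  gca2 v := by
    classical
    simp only [star_toL2, ← toL2_trans]
    ext φ α
    rw [sum_toL2_apply]
    -- `s_e s_e^*` is multiplication by the indicator of the paths that begin with `e`, so for a
    -- given `α` only `e = α_0` contributes to the sum.
    have h : ∀ e, ((removeEdge e).trans (removeEdge e).symm).toL2 φ α =
        if α.1 0 = e then φ α else 0 := fun e => by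
      rw [toL2_apply]
      change ((removeEdge e α).bind _).elim _ _ = _
      rw [removeEdge_apply]
      split_ifs with h
      · subst h
        simp [removeEdge_symm_apply, tgt_zero, cons_drop]
      · rfl
    simp only [h, toL2_apply, atVertex_apply]
    rw [Finset.sum_ite_eq]
    simp only [Finset.mem_filter, Finset.mem_univ, true_and]
    split_ifs <;> rfl
  unit := by
    classical
    ext φ α
    rw [sum_toL2_apply]
    simp only [toL2_apply, atVertex_apply]
    rw [Finset.sum_eq_single (E.src (α.1 0))]
    · simp
    · intro v _ hv
      simp [hv.symm]
    · simp
end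

noncomputable section
variable {V Ed : Type u} [Fintype V] [Fintype Ed] {E : DiGraph V Ed}
open DiGraph InfPath PEquiv

namespace CKFamily

open Classical in
lemma l2_star_s_delta (e : Ed) (α : E.InfPath) :
    star (l2.s e) (delta α) = if α.1 0 = e then delta (α.drop 1) else 0 := by
  change star (removeEdge e).toL2 _ = _
  rw [star_toL2, toL2_delta, PEquiv.symm_symm, removeEdge_apply]
  split_ifs <;> rfl

lemma l2_s_delta (α : E.InfPath) : l2.s (α.1 0) (delta (α.drop 1)) = delta α := by
  change (removeEdge _).toL2 _ = _
  rw [toL2_delta, removeEdge_symm_apply, dif_pos α.tgt_zero, cons_drop]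
  rfl

open Classical in
lemma l2_p_delta (v : V) (α : E.InfPath) :
    l2.p v (delta α) = if E.src (α.1 0) = v then delta α else 0 := by
  change (atVertex v).toL2 _ = _
  rw [toL2_delta]
  change (atVertex v α).elim _ _ = _
  rw [atVertex_apply]
  split_ifs <;> rfl

lemma l2_star_path_delta {μ : E.FinPath} {α : E.InfPath} (h : μ.IsInitial α) :
    star (l2.path μ) (delta α) = delta (α.drop μ.length) := by
  induction μ using FinPath.induction generalizing α with
  | nil v =>
    rw [path_nil, star_p, l2_p_delta, if_pos (FinPath.isInitial_nil.1 h)]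
    rfl
  | cons e μ he ih =>
    obtain ⟨h1, h2⟩ := FinPath.isInitial_cons.1 h
    rw [path_cons, star_mul, mul_apply_eq_comp, l2_star_s_delta, if_pos h1, ih h2,
      drop_drop]
    rfl

lemma l2_star_path_delta_of_not {μ : E.FinPath} {α : E.InfPath} (h : ¬ μ.IsInitial α) :
    star (l2.path μ) (delta α) = 0 := by
  induction μ using FinPath.induction generalizing α with
  | nil v =>
    rw [path_nil, star_p, l2_p_delta, if_neg (mt FinPath.isInitial_nil.2 h)]
  | cons e μ he ih =>
    rw [path_cons, star_mul, mul_apply_eq_comp, l2_star_s_delta]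
    split_ifs with h1
    · exact ih fun h2 => h (FinPath.isInitial_cons.2 ⟨h1, h2⟩)
    · simp

lemma l2_path_delta {μ : E.FinPath} {α : E.InfPath} (h : μ.IsInitial α) :
    l2.path μ (delta (α.drop μ.length)) = delta α := by
  induction μ using FinPath.induction generalizing α with
  | nil v =>
    rw [path_nil, l2_p_delta]
    exact if_pos (FinPath.isInitial_nil.1 h)
  | cons e μ he ih =>
    obtain ⟨rfl, h2⟩ := FinPath.isInitial_cons.1 h
    rw [path_cons, mul_apply_eq_comp, FinPath.length_cons, ← drop_drop _ 1, ih h2,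
      l2_s_delta]

lemma l2_path_delta_of_ne {μ : E.FinPath} {β : E.InfPath} (h : E.src (β.1 0) ≠ μ.finish) :
    l2.path μ (delta β) = 0 := by
  rw [← path_mul_p, mul_apply_eq_comp, l2_p_delta, if_neg h, map_zero]

/-- `s_γ` either kills `δ_β` or maps it to `δ_{γβ}`, and basis vectors are nonzero and distinct. In
this way an identity between operators yields a factorization of paths. -/
lemma isInitial_of_l2_path_delta {γ : E.FinPath} {β α : E.InfPath}
    (h : l2.path γ (delta β) = delta α) : γ.IsInitial α ∧ α.drop γ.length = β := by
  have hs : E.src (β.1 0) = γ.finish := by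
    by_contra hs
    rw [l2_path_delta_of_ne hs] at h
    exact delta_ne_zero α h.symm
  obtain ⟨α', h1, rfl⟩ := γ.exists_isInitial β hs
  rw [l2_path_delta h1] at h
  obtain rfl := delta_injective h
  exact ⟨h1, rfl⟩

end CKFamily

/-! ### Vector states of infinite paths and the spectrum of the diagonal. -/

namespace GraphCStar

open CKFamily
open scoped InnerProductSpace

/-- The representation of `C^*(E)` on `ℓ²(E^∞)`. -/
def rep [h : Nonempty E.InfPath] :
    GraphCStar E →⋆ₐ[ℂ] (lp (fun _ : E.InfPath => ℂ) 2 →L[ℂ] lp (fun _ : E.InfPath => ℂ) 2) :=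
  eval
    { carrier := lp (fun _ : E.InfPath => ℂ) 2 →L[ℂ] lp (fun _ : E.InfPath => ℂ) 2
      nontriv := ⟨1, 0, fun h10 => delta_ne_zero h.some
        (by simpa using congr($h10 (delta h.some)))⟩
      fam := l2 }

lemma rep_s [Nonempty E.InfPath] (e : Ed) : rep (univ.s e) = l2.s (E := E) e := rfl

lemma rep_p [Nonempty E.InfPath] (v : V) : rep (univ.p v) = l2.p (E := E) v := rfl

lemma rep_path [Nonempty E.InfPath] (μ : E.FinPath) : rep (univ.path μ) = l2.path μ := by
  rw [path, path, map_mul, rep_p, map_list_prod, List.map_map]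
  rfl

lemma rep_ofLeavitt [Nonempty E.InfPath] (x : Leavitt E) :
    rep (univ.ofLeavitt x) = l2.ofLeavitt x := by
  change ((RingHomClass.toRingHom (rep (E := E))).comp univ.ofLeavitt) x = _
  congr 1
  apply Leavitt.hom_ext
  · intro v; simp [ofLeavitt_P, rep_p]
  · intro v; simp [ofLeavitt_S, rep_s]
  · intro v; simp [ofLeavitt_Sstar, rep_s, map_star]

/-- The vector state of `C^*(E)` that belongs to an infinite path. -/
def vecState (α : E.InfPath) : GraphCStar E →ₗ[ℂ] ℂ where
  toFun x := haveI : Nonempty E.InfPath := ⟨α⟩; ⟪delta α, rep x (delta α)⟫_ℂ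
  map_add' x y := by
    rw [map_add, add_apply, inner_add_right]
  map_smul' c x := by
    rw [map_smul, smul_apply, inner_smul_right]; rfl

lemma vecState_apply [Nonempty E.InfPath] (α : E.InfPath) (x : GraphCStar E) :
    vecState α x = ⟪delta α, rep x (delta α)⟫_ℂ := rfl

lemma continuous_rep_apply [Nonempty E.InfPath] (φ : lp (fun _ : E.InfPath => ℂ) 2) :
    Continuous fun x : GraphCStar E => rep x φ :=
  (ContinuousLinearMap.apply ℂ _ φ).continuous.comp (map_continuous rep)

lemma continuous_vecState (α : E.InfPath) : Continuous (vecState α) := by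
  have : Nonempty E.InfPath := ⟨α⟩
  exact continuous_const.inner (continuous_rep_apply _)

/-- Moving `w` to the other side of the inner product leaves `δ_β` on both sides. Conjugation by `u`
and by `s_e` thereby turns into a map of infinite paths. -/
lemma vecState_conj [Nonempty E.InfPath] {w x : GraphCStar E} {α β : E.InfPath}
    (h : star (rep w) (delta α) = delta β) : vecState α (w * x * star w) = vecState β x := by
  rw [vecState_apply, vecState_apply, map_mul, map_mul, map_star, mul_apply_eq_comp,
    mul_apply_eq_comp, h, ← h, ContinuousLinearMap.star_eq_adjoint,
    ContinuousLinearMap.adjoint_inner_left]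

lemma vecState_conj_eq_zero [Nonempty E.InfPath] {w x : GraphCStar E} {α : E.InfPath}
    (h : star (rep w) (delta α) = 0) : vecState α (w * x * star w) = 0 := by
  rw [vecState_apply, map_mul, map_mul, map_star, mul_apply_eq_comp,
    mul_apply_eq_comp, h, map_zero, map_zero, inner_zero_right]

lemma vecState_one (α : E.InfPath) : vecState α 1 = 1 := by
  have : Nonempty E.InfPath := ⟨α⟩
  rw [vecState_apply, map_one, one_apply_eq_self, inner_delta, delta_apply, if_pos rfl]

lemma rep_rp_delta [Nonempty E.InfPath] {μ : E.FinPath} {α : E.InfPath} (h : μ.IsInitial α) :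
    rep (univ.rp μ) (delta α) = delta α := by
  rw [rp, map_mul, map_star, rep_path, mul_apply_eq_comp, l2_star_path_delta h,
    l2_path_delta h]

lemma rep_rp_delta_of_not [Nonempty E.InfPath] {μ : E.FinPath} {α : E.InfPath}
    (h : ¬ μ.IsInitial α) : rep (univ.rp μ) (delta α) = 0 := by
  rw [rp, map_mul, map_star, rep_path, mul_apply_eq_comp, l2_star_path_delta_of_not h,
    map_zero]

lemma vecState_rp {μ : E.FinPath} {α : E.InfPath} (h : μ.IsInitial α) :
    vecState α (univ.rp μ) = 1 := by
  have : Nonempty E.InfPath := ⟨α⟩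
  rw [vecState_apply, rep_rp_delta h, inner_delta_self]

lemma vecState_rp_of_not {μ : E.FinPath} {α : E.InfPath} (h : ¬ μ.IsInitial α) :
    vecState α (univ.rp μ) = 0 := by
  have : Nonempty E.InfPath := ⟨α⟩
  rw [vecState_apply, rep_rp_delta_of_not h, inner_zero_right]

/-- The basis vector of an infinite path is a common eigenvector of the diagonal. -/
lemma rep_diagonal_delta [Nonempty E.InfPath] {x : GraphCStar E} (hx : x ∈ diagonal E)
    (α : E.InfPath) : rep x (delta α) = vecState α x • delta α := by
  let f : GraphCStar E →ₗ[ℂ] lp (fun _ : E.InfPath => ℂ) 2 :=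
    { toFun := fun x => rep x (delta α)
      map_add' := fun x y => by rw [map_add, add_apply]
      map_smul' := fun c x => by rw [map_smul, smul_apply]; rfl }
  refine eqOn_diagonal (f := f) (g := (vecState α).smulRight (delta α)) (continuous_rep_apply _)
    ((continuous_vecState α).smul continuous_const) (fun μ => ?_) hx
  change rep (univ.rp μ) (delta α) = vecState α (univ.rp μ) • delta α
  by_cases h : μ.IsInitial α
  · rw [rep_rp_delta h, vecState_rp h, one_smul]
  · rw [rep_rp_delta_of_not h, vecState_rp_of_not h, zero_smul]

open WeakDual

/-- The character of the diagonal that belongs to an infinite path. -/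
def pathChar (α : E.InfPath) : characterSpace ℂ (diagonal E) :=
  CharacterSpace.equivAlgHom.symm
    (AlgHom.ofLinearMap ((vecState α).comp (diagonal E).toSubalgebra.toSubmodule.subtype)
      (vecState_one α) (fun x y => by
        have : Nonempty E.InfPath := ⟨α⟩
        change vecState α (x.1 * y.1) = vecState α x.1 * vecState α y.1
        rw [vecState_apply, map_mul, mul_apply_eq_comp, rep_diagonal_delta y.2,
          map_smul, rep_diagonal_delta x.2, inner_smul_right, inner_smul_right, inner_delta_self,
          mul_one, mul_comm]))

lemma pathChar_apply (α : E.InfPath) (x : diagonal E) : pathChar α x = vecState α x.1 := rfl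

lemma character_ext {χ χ' : characterSpace ℂ (diagonal E)}
    (h : ∀ μ, χ (rangeProj μ) = χ' (rangeProj μ)) : χ = χ' := by
  apply CharacterSpace.ext
  intro x
  exact congr($(diagonal_linearMap_ext (f := (CharacterSpace.toCLM χ : diagonal E →ₗ[ℂ] ℂ))
    (g := (CharacterSpace.toCLM χ' : diagonal E →ₗ[ℂ] ℂ)) (CharacterSpace.toCLM χ).continuous
    (CharacterSpace.toCLM χ').continuous h) x)

lemma rangeProj_mul_self (μ : E.FinPath) : rangeProj μ * rangeProj μ = rangeProj μ :=
  Subtype.ext <| by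
    change univ.rp μ * univ.rp μ = univ.rp μ
    rcases univ.rp_mul_rp μ μ with h | h | h <;> try exact h
    -- In the remaining case the square is `0`, and then the C*-identity makes the projection itself
    -- `0`.
    rw [h]
    have : star (univ.rp μ) * univ.rp μ = 0 := by rw [univ.star_rp, h]
    exact ((CStarRing.star_mul_self_eq_zero_iff _).1 this).symm

lemma character_rangeProj (χ : characterSpace ℂ (diagonal E)) (μ : E.FinPath) :
    χ (rangeProj μ) = 0 ∨ χ (rangeProj μ) = 1 := by
  have h : χ (rangeProj μ) * χ (rangeProj μ) = χ (rangeProj μ) := by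
    rw [← map_mul, rangeProj_mul_self]
  rcases eq_or_ne (χ (rangeProj μ)) 0 with h0 | h0
  · exact .inl h0
  · exact .inr (mul_right_cancel₀ h0 (by rw [h, one_mul]))

lemma pathChar_injective : Function.Injective (pathChar (E := E)) := by
  intro α β h
  refine InfPath.ext fun n => ?_
  have h1 : pathChar α (rangeProj (α.take 0 (n + 1))) = 1 :=
    vecState_rp (FinPath.isInitial_take α _)
  rw [h] at h1
  have h2 : (α.take 0 (n + 1)).IsInitial β := by
    by_contra h2
    exact one_ne_zero (h1.symm.trans (vecState_rp_of_not h2))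
  have := h2.2 n (by simp [InfPath.take])
  simpa [InfPath.take] using this

open Classical in
-- A character is additive on `p_μ = ∑ p_{μe}`, so it cannot vanish on all summands.
lemma exists_snoc (χ : characterSpace ℂ (diagonal E)) (μ : E.FinPath)
    (h : χ (rangeProj μ) ≠ 0) :
    ∃ e, ∃ he : μ.finish = E.src e, χ (rangeProj (μ.snoc e he)) ≠ 0 := by
  by_contra! hc
  let t : Ed → diagonal E := fun e =>
    if he : μ.finish = E.src e then rangeProj (μ.snoc e he) else 0
  have ht : rangeProj μ = ∑ e, t e := by
    apply Subtype.ext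
    rw [AddSubmonoidClass.coe_finsetSum, rangeProj_coe, univ.rp_eq_sum, Finset.sum_filter]
    refine Finset.sum_congr rfl fun e _ => ?_
    by_cases he : μ.finish = E.src e
    · rw [if_pos he.symm]
      simp only [t, dif_pos he, rangeProj_coe]
      rw [rp, univ.path_snoc]
    · rw [if_neg (Ne.symm he)]
      simp only [t, dif_neg he]
      rfl
  rw [ht, map_sum] at h
  refine h (Finset.sum_eq_zero fun e _ => ?_)
  by_cases he : μ.finish = E.src e
  · simp only [t, dif_pos he, hc e he]
  · simp only [t, dif_neg he, map_zero]

lemma exists_vertex (χ : characterSpace ℂ (diagonal E)) :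
    ∃ v, χ (rangeProj (FinPath.nil v)) ≠ 0 := by
  by_contra! hc
  have h : (1 : diagonal E) = ∑ v, rangeProj (FinPath.nil v) := by
    apply Subtype.ext
    rw [AddSubmonoidClass.coe_finsetSum]
    simp only [rangeProj_coe, univ.rp_nil]
    exact univ.unit.symm
  have h1 : χ 1 = 0 := by rw [h, map_sum]; exact Finset.sum_eq_zero fun v _ => hc v
  rw [map_one] at h1
  exact one_ne_zero h1

/-- A path on which `χ` does not vanish can be prolonged edge by edge with the same property, which
produces `α` in the limit. -/
lemma pathChar_surjective : Function.Surjective (pathChar (E := E)) := by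
  intro χ
  obtain ⟨v, hv⟩ := exists_vertex χ
  choose f hf hf' using fun μ : {μ : E.FinPath // χ (rangeProj μ) ≠ 0} => exists_snoc χ μ.1 μ.2
  let m : ℕ → {μ : E.FinPath // χ (rangeProj μ) ≠ 0} := fun n =>
    Nat.rec ⟨FinPath.nil v, hv⟩ (fun _ μ => ⟨μ.1.snoc (f μ) (hf μ), hf' μ⟩) n
  have hm : ∀ n, (m (n + 1)).1 = (m n).1.snoc (f (m n)) (hf (m n)) := fun n => rfl
  let α : E.InfPath := ⟨fun n => f (m n), fun n => by
    rw [← hf (m (n + 1)), hm, FinPath.finish_snoc]⟩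
  have hstart : ∀ n, (m n).1.start = v := fun n => by
    induction n with
    | zero => rfl
    | succ n ih => exact ih
  have hlen : ∀ n, (m n).1.edges.length = n := fun n => by
    induction n with
    | zero => rfl
    | succ n ih => rw [hm]; simp [FinPath.snoc, ih]
  have hinit : ∀ n, (m n).1.IsInitial α := fun n => by
    refine ⟨(hf (m 0)).symm.trans (hstart n).symm, ?_⟩
    induction n with
    | zero => exact fun i hi => absurd hi (Nat.not_lt_zero i)
    | succ n ih =>
      intro i hi
      have hi' : i < n + 1 := hi.trans_eq (hlen (n + 1))
      simp only [hm, FinPath.snoc, List.getElem_append]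
      split_ifs with h
      · exact ih i h
      · rw [hlen] at h
        obtain rfl : i = n := by omega
        simp [α]
  refine ⟨α, character_ext fun μ => ?_⟩
  have hμm := hinit μ.length
  by_cases h : μ.IsInitial α
  · have : μ = (m μ.length).1 := by
      refine h.eq_take.trans (Eq.trans ?_ hμm.eq_take.symm)
      rw [FinPath.length, FinPath.length, hlen]
    have h1 := (character_rangeProj χ μ).resolve_left (by rw [this]; exact (m _).2)
    rw [h1]
    exact vecState_rp h
  · refine (vecState_rp_of_not h).trans ?_
    by_contra h0
    -- The initial segment of `α` of the same length as `μ` has a projection orthogonal to `p_μ`,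
    -- and `χ` does not vanish there, so `χ(p_μ) = 0`.
    have hne : μ ≠ (m μ.length).1 := fun h' => h (h' ▸ hμm)
    have hz : rangeProj μ * rangeProj (m μ.length).1 = 0 :=
      Subtype.ext (univ.rp_mul_rp_of_ne (hlen _).symm hne)
    have := congr(χ $hz)
    rw [map_mul, map_zero] at this
    exact (mul_ne_zero (Ne.symm h0) (m μ.length).2) this

/-- The identification of `E^∞` with the spectrum of the diagonal. -/
def pathSpectrum : E.InfPath ≃ₜ characterSpace ℂ (diagonal E) := by
  let e := (Equiv.ofBijective _ ⟨pathChar_injective (E := E), pathChar_surjective⟩).symm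
  -- Continuity is shown for the map from the spectrum to `E^∞`, because the spectrum is known to be
  -- compact and `E^∞` to be Hausdorff. Compactness of `E^∞` is then a consequence.
  refine (Continuous.homeoOfEquivCompactToT2 (f := e) (InfPath.continuous_of_isOpen fun n a => ?_)).symm
  have : {χ : characterSpace ℂ (diagonal E) | (e χ).1 n = a} =
      ⋃ (μ : E.FinPath) (_ : ∃ h : n < μ.edges.length, μ.edges[n] = a),
        {χ | χ (rangeProj μ) ≠ 0} := by
    ext χ
    obtain ⟨α, rfl⟩ := pathChar_surjective χ
    have hα : e (pathChar α) = α := e.symm_apply_eq.1 rfl |>.symm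
    simp only [Set.mem_ofPred_eq, Set.mem_iUnion, hα]
    constructor
    · rintro rfl
      refine ⟨α.take 0 (n + 1), ⟨by simp [InfPath.take], by simp [InfPath.take]⟩, ?_⟩
      rw [pathChar_apply, rangeProj_coe, vecState_rp (FinPath.isInitial_take _ _)]
      exact one_ne_zero
    · rintro ⟨μ, ⟨h1, rfl⟩, h2⟩
      by_contra h3
      refine h2 (vecState_rp_of_not fun h4 => h3 (h4.2 n h1).symm)
  rw [this]
  refine isOpen_iUnion fun μ => isOpen_iUnion fun _ => ?_
  exact isOpen_ne.preimage ((WeakDual.eval_continuous (rangeProj μ)).comp continuous_subtype_val)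

instance : CompactSpace E.InfPath := pathSpectrum.symm.compactSpace

lemma isPathSpectrum : IsPathSpectrum (pathSpectrum (E := E)) :=
  fun _ _ => ⟨vecState_rp, vecState_rp_of_not⟩

attribute [local instance] diagonalCommCStarAlgebra

/-- All characters come from paths and the Gelfand transform is injective, so identities in the
diagonal may be tested on infinite paths. -/
lemma diagonal_eq_zero {x : GraphCStar E} (hx : x ∈ diagonal E) (h : ∀ α, vecState α x = 0) :
    x = 0 := by
  have : (⟨x, hx⟩ : diagonal E) = 0 := by
    apply (gelfandStarTransform (diagonal E)).injective
    rw [map_zero]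
    ext χ
    obtain ⟨α, rfl⟩ := pathChar_surjective χ
    exact h α
  exact congr(($this : GraphCStar E))

end GraphCStar

/-- A homomorphism of commutative C*-algebras that induces a homeomorphism of the spectra is
bijective. -/
lemma StarAlgHom.bijective_of_bijective_comp {A B : Type*} [CommCStarAlgebra A]
    [CommCStarAlgebra B] (f : A →⋆ₐ[ℂ] B)
    (hf : Function.Bijective (WeakDual.CharacterSpace.compContinuousMap f)) :
    Function.Bijective f := by
  open WeakDual in
  constructor
  · refine (injective_iff_map_eq_zero f).2 fun x hx => ?_
    apply (gelfandStarTransform A).injective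
    rw [map_zero]
    ext χ
    obtain ⟨χ', rfl⟩ := hf.2 χ
    change χ' (f x) = 0
    rw [hx, map_zero]
  · intro y
    let h := Continuous.homeoOfEquivCompactToT2 (f := Equiv.ofBijective _ hf)
      (map_continuous (CharacterSpace.compContinuousMap f))
    -- The Gelfand transform of `y`, carried over to the spectrum of `A` by the homeomorphism `h`,
    -- is the transform of a preimage.
    refine ⟨(gelfandStarTransform A).symm
      ((gelfandStarTransform B y).comp ⟨h.symm, h.symm.continuous⟩), ?_⟩
    apply (gelfandStarTransform B).injective
    ext χ
    have h1 := congr($((gelfandStarTransform A).apply_symm_apply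
      ((gelfandStarTransform B y).comp ⟨h.symm, h.symm.continuous⟩)) (h χ))
    refine h1.trans ?_
    change gelfandStarTransform B y (h.symm (h χ)) = _
    rw [h.symm_apply_apply]
    rfl
end

/-! ### The map of infinite paths induced by `λ_u`. -/

noncomputable section
variable {V Ed : Type u} {E : DiGraph V Ed}
open DiGraph InfPath PEquiv

namespace CodingSet

variable {J : CodingSet E}

/-- The path `ν` of a vertex `(μ, ν)` of the coding graph. -/
def Vertex.nu (x : J.Vertex) : E.FinPath := x.1.2

lemma Vertex.nu_eq (x : J.Vertex) : ∃ h, x.nu = FinPath.cons x.head x.kappa h :=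
  x.1.2.cons_tail_head (J.pos x.1 x.2)

lemma Vertex.finish_eq (x : J.Vertex) : x.mu.finish = x.nu.finish := J.finish_eq x.1 x.2

lemma Vertex.start_eq (x : J.Vertex) : x.mu.start = x.nu.start := J.start_eq x.1 x.2

end CodingSet

variable [Fintype V] [Fintype Ed]

open scoped InnerProductSpace in
/-- If `w = ∑ s_a s_b^*` is a coisometry, then every infinite path has exactly one of the paths `a`
as an initial segment: the number of these segments is at most the square of the norm of the sum of
the basis vectors that make up `w^* δ_α`. -/
lemma CKFamily.l2_existsUnique_isInitial {ι : Type*} (K : Finset ι) (a b : ι → E.FinPath)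
    (hab : ∀ i ∈ K, (a i).finish = (b i).finish)
    (hw : (∑ i ∈ K, l2.path (a i) * star (l2.path (b i))) *
      star (∑ i ∈ K, l2.path (a i) * star (l2.path (b i))) = 1) (α : E.InfPath) :
    ∃! i, i ∈ K ∧ (a i).IsInitial α := by
  classical
  have : Nonempty E.InfPath := ⟨α⟩
  set w := ∑ i ∈ K, l2.path (a i) * star (l2.path (b i)) with hwdef
  let K' := K.filter fun i => (a i).IsInitial α
  have hex : ∀ i ∈ K', ∃ y, l2.path (b i) (star (l2.path (a i)) (delta α)) = delta y := by
    intro i hi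
    obtain ⟨hiK, hi⟩ := Finset.mem_filter.1 hi
    obtain ⟨y, hy, hy'⟩ := (b i).exists_isInitial _ (hi.src_drop.trans (hab i hiK))
    exact ⟨y, by rw [l2_star_path_delta hi, ← hy', l2_path_delta hy]⟩
  choose! y hy using hex
  have hstar : star w (delta α) = ∑ i ∈ K', delta (y i) := by
    rw [hwdef, star_sum, sum_apply, Finset.sum_filter]
    refine Finset.sum_congr rfl fun i hi => ?_
    rw [star_mul, star_star, mul_apply_eq_comp]
    split_ifs with h
    · exact hy i (Finset.mem_filter.2 ⟨hi, h⟩)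
    · rw [l2_star_path_delta_of_not h, map_zero]
  have hinner : ⟪star w (delta α), star w (delta α)⟫_ℂ = 1 := by
    rw [ContinuousLinearMap.star_eq_adjoint, ContinuousLinearMap.adjoint_inner_left,
      ← ContinuousLinearMap.star_eq_adjoint, ← mul_apply_eq_comp, hw, one_apply_eq_self,
      inner_delta_self]
  -- Different indices could give the same path `y i`, so the squared norm counts pairs `(i, j)`
  -- with `y i = y j`. The diagonal pairs alone give `K'.card ≤ 1`, and an empty `K'` would give
  -- `0`.
  have hcount : ∑ i ∈ K', ∑ j ∈ K', (if y i = y j then 1 else 0) = 1 := by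
    have : ((∑ i ∈ K', ∑ j ∈ K', (if y i = y j then 1 else 0) : ℕ) : ℂ) = (1 : ℕ) := by
      rw [Nat.cast_one, ← hinner, hstar, sum_inner]
      push_cast
      refine Finset.sum_congr rfl fun i _ => ?_
      rw [inner_sum]
      refine Finset.sum_congr rfl fun j _ => ?_
      rw [inner_delta, delta_apply]
    exact_mod_cast this
  have hle : K'.card ≤ 1 := by
    rw [← hcount, Finset.card_eq_sum_ones]
    refine Finset.sum_le_sum fun i hi => ?_
    calc 1 = if y i = y i then 1 else 0 := (if_pos rfl).symm
      _ ≤ _ := Finset.single_le_sum (f := fun j => if y i = y j then 1 else 0)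
        (fun _ _ => Nat.zero_le _) hi
  have hne : K'.Nonempty := by
    rw [Finset.nonempty_iff_ne_empty]
    intro h
    rw [h, Finset.sum_empty] at hcount
    exact zero_ne_one hcount
  obtain ⟨i, hi⟩ := hne
  refine ⟨i, Finset.mem_filter.1 hi, fun j hj => ?_⟩
  exact Finset.card_le_one.1 hle _ (Finset.mem_filter.2 hj) _ hi

namespace CodingSet

variable {J : CodingSet E}

lemma ofLeavitt_u {A : Type*} [CStarAlgebra A] (F : CKFamily E A) :
    F.ofLeavitt J.u = ∑ x ∈ J.pairs, F.path x.1 * star (F.path x.2) := by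
  rw [u, map_sum]
  refine Finset.sum_congr rfl fun x _ => ?_
  rw [map_mul, CKFamily.ofLeavitt_star, CKFamily.ofLeavitt_path, CKFamily.ofLeavitt_path]

section

variable (hu : J.u ∈ unitary (Leavitt E))

include hu

/-- This is the half `u u^* = 1` of unitarity. -/
lemma existsUnique_mu (α : E.InfPath) : ∃! x : J.Vertex, x.mu.IsInitial α := by
  obtain ⟨x, ⟨hx, hx'⟩, h⟩ := CKFamily.l2_existsUnique_isInitial J.pairs Prod.fst Prod.snd
    J.finish_eq (by
      rw [← ofLeavitt_u, ← CKFamily.ofLeavitt_star, ← map_mul, (Unitary.mem_iff.1 hu).2,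
        map_one]) α
  exact ⟨⟨x, hx⟩, hx', fun y hy => Subtype.ext (h y.1 ⟨y.2, hy⟩)⟩

/-- This is the half `u^* u = 1`, that is, the coisometry statement for `u^*`, in whose sum `μ` and
`ν` change places. -/
lemma existsUnique_nu (α : E.InfPath) : ∃! x : J.Vertex, x.nu.IsInitial α := by
  have hs : ∑ x ∈ J.pairs, CKFamily.l2.path x.2 * star (CKFamily.l2.path x.1) =
      CKFamily.l2.ofLeavitt (star J.u) := by
    rw [CKFamily.ofLeavitt_star, ofLeavitt_u, star_sum]
    exact Finset.sum_congr rfl fun x _ => by rw [star_mul, star_star]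
  obtain ⟨x, ⟨hx, hx'⟩, h⟩ := CKFamily.l2_existsUnique_isInitial J.pairs Prod.snd Prod.fst
    (fun x hx => (J.finish_eq x hx).symm) (by
      rw [hs, ← CKFamily.ofLeavitt_star, star_star, ← map_mul, (Unitary.mem_iff.1 hu).1,
        map_one]) α
  exact ⟨⟨x, hx⟩, hx', fun y hy => Subtype.ext (h y.1 ⟨y.2, hy⟩)⟩

end

variable (hu : J.u ∈ unitary (Leavitt E))

/-- The pair `(μ, ν)` for which `μ` is an initial segment of `α`. -/
def vtx (α : E.InfPath) : J.Vertex := (existsUnique_mu hu α).choose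

lemma vtx_isInitial (α : E.InfPath) : (vtx hu α).mu.IsInitial α :=
  (existsUnique_mu hu α).choose_spec.1

lemma vtx_eq {α : E.InfPath} {x : J.Vertex} (h : x.mu.IsInitial α) : vtx hu α = x :=
  (existsUnique_mu hu α).unique (vtx_isInitial hu α) h

lemma exists_pre (α : E.InfPath) : ∃ β : E.InfPath, (vtx hu α).nu.IsInitial β ∧
    β.drop (vtx hu α).nu.length = α.drop (vtx hu α).mu.length :=
  (vtx hu α).nu.exists_isInitial _ ((vtx_isInitial hu α).src_drop.trans (vtx hu α).finish_eq)

/-- The infinite path `ν β`, if the given path is `μ β`. -/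
def pre (α : E.InfPath) : E.InfPath := (exists_pre hu α).choose

lemma pre_isInitial (α : E.InfPath) : (vtx hu α).nu.IsInitial (pre hu α) :=
  (exists_pre hu α).choose_spec.1

lemma pre_drop (α : E.InfPath) :
    (pre hu α).drop (vtx hu α).nu.length = α.drop (vtx hu α).mu.length :=
  (exists_pre hu α).choose_spec.2

lemma src_pre (α : E.InfPath) : E.src ((pre hu α).1 0) = E.src (α.1 0) := by
  rw [(pre_isInitial hu α).1, (vtx_isInitial hu α).1, (vtx hu α).start_eq]

/-- The infinite path `κ β`, if the given path is `μ β` with `ν = e κ`. -/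
def next (α : E.InfPath) : E.InfPath := (pre hu α).drop 1

lemma pre_zero (α : E.InfPath) : (pre hu α).1 0 = (vtx hu α).head := by
  obtain ⟨h, h'⟩ := (vtx hu α).nu_eq
  have := pre_isInitial hu α
  rw [h'] at this
  exact (FinPath.isInitial_cons.1 this).1

lemma next_isInitial (α : E.InfPath) : (vtx hu α).kappa.IsInitial (next hu α) := by
  obtain ⟨h, h'⟩ := (vtx hu α).nu_eq
  have := pre_isInitial hu α
  rw [h'] at this
  exact (FinPath.isInitial_cons.1 this).2

lemma next_drop (α : E.InfPath) :
    (next hu α).drop (vtx hu α).kappa.length = α.drop (vtx hu α).mu.length := by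
  obtain ⟨h, h'⟩ := (vtx hu α).nu_eq
  rw [← pre_drop, next, drop_drop, h', FinPath.length_cons]

/-- The sequence of the edges `e` of the pairs `(μ, e κ)` that belong to the iterates of `next`. -/
def code (α : E.InfPath) : E.InfPath :=
  ⟨fun n => (pre hu ((next hu)^[n] α)).1 0, fun n => by
    rw [tgt_zero, src_pre, Function.iterate_succ_apply']; rfl⟩

lemma code_drop (α : E.InfPath) : (code hu α).drop 1 = code hu (next hu α) := rfl

lemma src_code (α : E.InfPath) : E.src ((code hu α).1 0) = E.src (α.1 0) := src_pre hu α

/-- Only the summand of the pair whose `μ` begins `α` survives, and it replaces `μ` by `ν`. -/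
lemma rep_u_star_delta [Nonempty E.InfPath] (α : E.InfPath) :
    star (GraphCStar.rep (GraphCStar.univ.ofLeavitt J.u)) (delta α) = delta (pre hu α) := by
  rw [GraphCStar.rep_ofLeavitt, ofLeavitt_u, star_sum, sum_apply,
    Finset.sum_eq_single (vtx hu α).1]
  · rw [star_mul, star_star, mul_apply_eq_comp]
    have h := CKFamily.l2_star_path_delta (vtx_isInitial hu α)
    have h' := CKFamily.l2_path_delta (pre_isInitial hu α)
    rw [pre_drop, ← h] at h'
    exact h'
  · intro x hx hne
    rw [star_mul, star_star, mul_apply_eq_comp, CKFamily.l2_star_path_delta_of_not, map_zero]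
    exact fun h => hne congr(Subtype.val $(vtx_eq hu (x := ⟨x, hx⟩) h)).symm
  · exact fun h => absurd (vtx hu α).2 h

open GraphCStar

include hu in
-- No infinite path begins with both `ν`'s, and infinite paths separate the elements of the
-- diagonal.
lemma rp_mul_rp_eq_zero {x y : E.FinPath × E.FinPath} (hx : x ∈ J.pairs)
    (hy : y ∈ J.pairs) (hne : x ≠ y) : univ.rp x.2 * univ.rp y.2 = 0 := by
  refine diagonal_eq_zero (mul_mem (rp_mem _) (rp_mem _)) fun α => ?_
  have : Nonempty E.InfPath := ⟨α⟩
  rw [vecState_apply, map_mul, mul_apply_eq_comp]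
  by_cases h : y.2.IsInitial α
  · have h' : ¬ x.2.IsInitial α := fun h' => hne congr(Subtype.val
      $((existsUnique_nu hu α).unique (y₁ := ⟨x, hx⟩) (y₂ := ⟨y, hy⟩) h' h))
    rw [rep_rp_delta h, rep_rp_delta_of_not h', inner_zero_right]
  · rw [rep_rp_delta_of_not h, map_zero, inner_zero_right]

include hu in
-- In the double sum for `u x u^*` the terms of a single pair are conjugates of `x` by path
-- elements. The mixed terms vanish: `x` commutes with the `p_ν`, which brings two orthogonal ones
-- together.
lemma conj_u_mem {x : GraphCStar E} (hx : x ∈ diagonal E) :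
    univ.ofLeavitt J.u * x * star (univ.ofLeavitt J.u) ∈ diagonal E := by
  rw [ofLeavitt_u, star_sum, Finset.sum_mul, Finset.sum_mul]
  refine sum_mem fun y hy => ?_
  rw [Finset.mul_sum]
  refine sum_mem fun z hz => ?_
  rw [star_mul, star_star]
  by_cases hyz : y = z
  · subst hyz
    simpa [mul_assoc] using conj_path_mem y.1 (conj_star_path_mem y.2 hx)
  · have h : star (univ.path y.2) * x * univ.path z.2 = 0 := by
      have h1 : star (univ.path y.2) = star (univ.path y.2) * univ.rp y.2 := by
        simpa [univ.star_rp] using congr(star $(univ.rp_mul_path y.2)).symm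
      rw [h1, ← univ.rp_mul_path z.2]
      calc _ = star (univ.path y.2) * (univ.rp y.2 * x) * univ.rp z.2 * univ.path z.2 := by
            simp only [mul_assoc]
        _ = star (univ.path y.2) * x * (univ.rp y.2 * univ.rp z.2) * univ.path z.2 := by
            rw [diagonal_commute (rp_mem _) hx]; simp only [mul_assoc]
        _ = 0 := by rw [rp_mul_rp_eq_zero hu hy hz hyz]; simp
    have : univ.path y.1 * star (univ.path y.2) * x * (univ.path z.2 * star (univ.path z.1)) =
        univ.path y.1 * (star (univ.path y.2) * x * univ.path z.2) * star (univ.path z.1) := by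
      simp only [mul_assoc]
    rw [this, h]
    simp

lemma lambda_rp_nil (v : V) : J.lambda hu (univ.rp (FinPath.nil v)) = univ.rp (FinPath.nil v) := by
  rw [univ.rp_nil]; exact GraphCStar.lambda_p _ _ _ v

lemma lambda_rp_cons (e : Ed) (μ : E.FinPath) (h : E.tgt e = μ.start) :
    J.lambda hu (univ.rp (FinPath.cons e μ h)) = univ.ofLeavitt J.u *
      (univ.s e * J.lambda hu (univ.rp μ) * star (univ.s e)) * star (univ.ofLeavitt J.u) := by
  have hs : J.lambda hu (univ.s e) = univ.ofLeavitt J.u * univ.s e := GraphCStar.lambda_s _ _ _ e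
  rw [univ.rp_cons, map_mul, map_mul, map_star, hs, star_mul]
  simp only [mul_assoc]

lemma lambda_mem {x : GraphCStar E} (hx : x ∈ diagonal E) : J.lambda hu x ∈ diagonal E := by
  refine map_mem_diagonal (f := (J.lambda hu).toAlgHom.toLinearMap)
    (map_continuous (J.lambda hu)) (fun μ => ?_) hx
  change J.lambda hu (univ.rp μ) ∈ diagonal E
  induction μ using FinPath.induction with
  | nil v => rw [lambda_rp_nil]; exact rp_mem _
  | cons e μ h ih =>
    rw [lambda_rp_cons]
    exact conj_u_mem hu (conj_s_mem e ih)

/-- The restriction of `λ_u` to the diagonal. -/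
def diagonalHom : diagonal E →⋆ₐ[ℂ] diagonal E :=
  StarAlgHom.codRestrict ((J.lambda hu).comp (diagonal E).subtype) (diagonal E)
    fun x => lambda_mem hu x.2

/-- In `u s_e λ_u(p_μ) s_e^* u^*` the factor `u^*` moves `δ_α` to `pre α`, and `s_e^*` tests whether
its first edge, which is the first letter of `code α`, equals `e`, and leaves `next α`. Since `code
(next α)` is `code α` without its first letter, the induction closes. -/
lemma vecState_lambda_rp (α : E.InfPath) (μ : E.FinPath) :
    vecState α (J.lambda hu (univ.rp μ)) = vecState (code hu α) (univ.rp μ) := by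
  have : Nonempty E.InfPath := ⟨α⟩
  induction μ using FinPath.induction generalizing α with
  | nil v =>
    rw [lambda_rp_nil]
    by_cases h : E.src (α.1 0) = v
    · rw [vecState_rp (FinPath.isInitial_nil.2 h), vecState_rp]
      exact FinPath.isInitial_nil.2 ((src_code hu α).trans h)
    · rw [vecState_rp_of_not (mt FinPath.isInitial_nil.1 h), vecState_rp_of_not]
      exact fun h' => h ((src_code hu α).symm.trans (FinPath.isInitial_nil.1 h'))
  | cons e μ h ih =>
    have hs : ∀ β : E.InfPath, star (rep (univ.s e)) (delta β) =
        star (CKFamily.l2.s e) (delta β) := fun β => rfl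
    rw [lambda_rp_cons, vecState_conj (rep_u_star_delta hu α), univ.rp_cons]
    by_cases he : (pre hu α).1 0 = e
    · have h1 := (hs (pre hu α)).trans ((CKFamily.l2_star_s_delta e _).trans (if_pos he))
      have h2 := (hs (code hu α)).trans ((CKFamily.l2_star_s_delta e _).trans (if_pos he))
      rw [vecState_conj h1, vecState_conj h2]
      exact ih (next hu α)
    · have h1 := (hs (pre hu α)).trans ((CKFamily.l2_star_s_delta e _).trans (if_neg he))
      have h2 := (hs (code hu α)).trans ((CKFamily.l2_star_s_delta e _).trans (if_neg he))
      rw [vecState_conj_eq_zero h1, vecState_conj_eq_zero h2]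

open WeakDual in
lemma comp_diagonalHom (α : E.InfPath) :
    CharacterSpace.compContinuousMap (diagonalHom hu) (pathSpectrum α) =
      pathSpectrum (code hu α) :=
  character_ext fun μ => vecState_lambda_rp hu α μ

lemma continuous_code : Continuous (code hu) := by
  have : code hu = pathSpectrum.symm ∘
      WeakDual.CharacterSpace.compContinuousMap (diagonalHom hu) ∘ pathSpectrum := by
    funext α
    simp only [Function.comp_apply, comp_diagonalHom, Homeomorph.symm_apply_apply]
  rw [this]
  exact pathSpectrum.symm.continuous.comp ((map_continuous _).comp pathSpectrum.continuous)

/-- The substitution `μ ↦ ν` can be undone: `eα` begins with some `ν`, and replacing it by its `μ`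
gives `β`. Uniqueness of `μ` ensures that `pre` uses the same pair. -/
lemma exists_code_eq_cons (e : Ed) (α : E.InfPath) (h : E.tgt e = E.src (α.1 0)) :
    ∃ β, (pre hu β).1 0 = e ∧ next hu β = α := by
  obtain ⟨x, hx, -⟩ := existsUnique_nu hu (InfPath.cons e α h)
  obtain ⟨β, hβ, hβ'⟩ := x.mu.exists_isInitial _ (hx.src_drop.trans x.finish_eq.symm)
  have hv := vtx_eq hu hβ
  have hp : pre hu β = InfPath.cons e α h := by
    have h1 := pre_isInitial hu β
    have h2 := pre_drop hu β
    rw [hv] at h1 h2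
    exact h1.eq hx (h2.trans hβ')
  exact ⟨β, by rw [hp]; rfl, by rw [next, hp]; rfl⟩

/-- Letters are prepended to a code one at a time; the absence of sinks supplies an infinite path to
start from. -/
lemma exists_isInitial_code (hsinks : E.NoSinks) (μ : E.FinPath) :
    ∃ α, μ.IsInitial (code hu α) := by
  induction μ using FinPath.induction with
  | nil v =>
    obtain ⟨α, hα⟩ := hsinks.exists_infPath v
    exact ⟨α, FinPath.isInitial_nil.2 ((src_code hu α).trans hα)⟩
  | cons e μ h ih =>
    obtain ⟨α, hα⟩ := ih
    obtain ⟨β, h1, h2⟩ := exists_code_eq_cons hu e α (by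
      rw [h, ← hα.1, src_code])
    refine ⟨β, FinPath.isInitial_cons.2 ⟨h1, ?_⟩⟩
    rw [code_drop, h2]
    exact hα

lemma code_surjective (hsinks : E.NoSinks) : Function.Surjective (code hu) := by
  intro β
  -- The codes of the `a n` share longer and longer initial segments with `β` and so converge to it;
  -- the image of `code` is compact, hence closed.
  choose a ha using fun n => exists_isInitial_code hu hsinks (β.take 0 n)
  have hlim : Filter.Tendsto (fun n => code hu (a n)) Filter.atTop (nhds β) := by
    let _ : TopologicalSpace Ed := ⊥
    have : DiscreteTopology Ed := ⟨rfl⟩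
    have hind : Topology.IsInducing (Subtype.val : E.InfPath → ℕ → Ed) := ⟨rfl⟩
    refine hind.tendsto_nhds_iff.2 (tendsto_pi_nhds.2 fun k => ?_)
    rw [nhds_discrete, Filter.tendsto_pure]
    filter_upwards [Filter.eventually_gt_atTop k] with n hn
    have := (ha n).2 k (by simpa [InfPath.take] using hn)
    change (code hu (a n)).1 k = β.1 k
    simpa [InfPath.take] using this.symm
  exact (isCompact_range (continuous_code hu)).isClosed.mem_of_tendsto hlim
    (Filter.Eventually.of_forall fun n => ⟨a n, rfl⟩)

end CodingSet
end

noncomputable section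
variable {V Ed : Type u} {E : DiGraph V Ed}
open DiGraph InfPath PEquiv

/-! ## Transducers -/

namespace Transducer

variable {A B C : Type u}

/-- The first `n` letters of an infinite word. -/
def pref (α : ℕ → A) (n : ℕ) : List A := (List.range n).map α

lemma pref_succ (α : ℕ → A) (n : ℕ) : pref α (n + 1) = pref α n ++ [α n] := by
  simp [pref, List.range_succ]

lemma run_append (T : Transducer A B) (q : T.State) (w w' : List A) :
    T.run q (w ++ w') =
      ((T.run (T.run q w).1 w').1, (T.run q w).2 ++ (T.run (T.run q w).1 w').2) := by
  induction w generalizing q with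
  | nil => rfl
  | cons a w ih => simp [run, ih]

lemma run_pref (T : Transducer A B) (α : ℕ → A) (n : ℕ) :
    T.run T.init (pref α n) = (T.stateAt α n, T.outputUpTo α n) := by
  induction n with
  | zero => rfl
  | succ n ih => rw [pref_succ, run_append, ih]; simp [run, stateAt, outputUpTo]

/-- The composite behaves as if `T'` read the whole word written by `T` so far, however that word
was cut into pieces. -/
lemma comp_run (T' : Transducer B C) (T : Transducer A B) (α : ℕ → A) (n : ℕ) :
    (T'.comp T).stateAt α n = (T.stateAt α n, (T'.run T'.init (T.outputUpTo α n)).1) ∧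
      (T'.comp T).outputUpTo α n = (T'.run T'.init (T.outputUpTo α n)).2 := by
  induction n with
  | zero => exact ⟨rfl, rfl⟩
  | succ n ih =>
    simp only [stateAt, outputUpTo, ih.1, ih.2, run_append]
    exact ⟨rfl, rfl⟩

lemma Outputs.eq_pref {T : Transducer A B} {α : ℕ → A} {β : ℕ → B} (h : T.Outputs α β) (n : ℕ) :
    T.outputUpTo α n = pref β (T.outputUpTo α n).length := by
  refine List.ext_getElem (by simp [pref]) fun i h1 h2 => ?_
  rw [h.1 n i h1]
  simp [pref]

lemma length_outputUpTo_mono (T : Transducer A B) (α : ℕ → A) :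
    Monotone fun n => (T.outputUpTo α n).length :=
  monotone_nat_of_le_succ fun n => by simp [outputUpTo]

lemma Outputs.comp {T' : Transducer B C} {T : Transducer A B} {α : ℕ → A} {β : ℕ → B} {γ : ℕ → C}
    (h : T.Outputs α β) (h' : T'.Outputs β γ) : (T'.comp T).Outputs α γ := by
  have key : ∀ n, (T'.comp T).outputUpTo α n = T'.outputUpTo β (T.outputUpTo α n).length :=
    fun n => by rw [(comp_run T' T α n).2, h.eq_pref n, run_pref]; simp [pref]
  refine ⟨fun n i hi => ?_, fun k => ?_⟩
  · simp only [key]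
    exact h'.1 _ i _
  · obtain ⟨l, hl⟩ := h'.2 k
    obtain ⟨n, hn⟩ := h.2 l
    exact ⟨n, hl.trans (by rw [key]; exact T'.length_outputUpTo_mono β hn)⟩

lemma Outputs.unique {T : Transducer A B} {α : ℕ → A} {β β' : ℕ → B} (h : T.Outputs α β)
    (h' : T.Outputs α β') : β = β' := by
  funext i
  obtain ⟨n, hn⟩ := h.2 (i + 1)
  rw [← h.1 n i hn, ← h'.1 n i hn]

/-- The transducer that computes a sliding block code with windows of length `k + 1`: it remembers
the last `k` letters. -/
def slidingBlock [Finite A] (k : ℕ) (φ : (Fin (k + 1) → A) → B) : Transducer A B where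
  State := {l : List A // l.length ≤ k}
  finite := (List.finite_length_le A k).to_subtype
  init := ⟨[], Nat.zero_le k⟩
  step q a :=
    if h : q.1.length = k then
      (⟨(q.1 ++ [a]).tail, by simp [h]⟩, [φ fun j => (q.1 ++ [a])[j.1]'(by simp only [List.length_append, h]; exact j.2)])
    else (⟨q.1 ++ [a], by have := q.2; simp; omega⟩, [])

lemma slidingBlock_step_of_eq [Finite A] (k : ℕ) (φ : (Fin (k + 1) → A) → B)
    (q : {l : List A // l.length ≤ k}) (a : A) (h : q.1.length = k) :
    ((slidingBlock k φ).step q a).1.1 = (q.1 ++ [a]).tail ∧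
      ((slidingBlock k φ).step q a).2 = [φ fun j => (q.1 ++ [a])[j.1]'(by
        simp only [List.length_append, h]; exact j.2)] := by
  have : (slidingBlock k φ).step q a = _ := dif_pos h
  rw [this]
  exact ⟨rfl, rfl⟩

lemma slidingBlock_step_of_ne [Finite A] (k : ℕ) (φ : (Fin (k + 1) → A) → B)
    (q : {l : List A // l.length ≤ k}) (a : A) (h : q.1.length ≠ k) :
    ((slidingBlock k φ).step q a).1.1 = q.1 ++ [a] ∧
      ((slidingBlock k φ).step q a).2 = [] := by
  have : (slidingBlock k φ).step q a = _ := dif_neg h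
  rw [this]
  exact ⟨rfl, rfl⟩

/-- Truncated subtraction and the minimum cover both phases: the first letters are all stored, later
only the last `k`. -/
lemma slidingBlock_stateAt [Finite A] (k : ℕ) (φ : (Fin (k + 1) → A) → B) (α : ℕ → A) (n : ℕ) :
    ((slidingBlock k φ).stateAt α n).1 = (List.range' (n - k) (min n k)).map α := by
  induction n with
  | zero => simp [stateAt, slidingBlock]
  | succ n ih =>
    have hlen : ((slidingBlock k φ).stateAt α n).1.length = min n k := by rw [ih]; simp
    have happ : ((slidingBlock k φ).stateAt α n).1 ++ [α n] =
        (List.range' (n - k) (min n k + 1)).map α := by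
      rw [ih, List.range'_1_concat, List.map_append, List.map_singleton]
      congr 3
      omega
    change ((slidingBlock k φ).step ((slidingBlock k φ).stateAt α n) (α n)).1.1 = _
    by_cases h : ((slidingBlock k φ).stateAt α n).1.length = k
    · rw [(slidingBlock_step_of_eq k φ _ _ h).1, happ, List.range'_succ, List.map_cons,
        List.tail_cons]
      congr 2 <;> omega
    · rw [(slidingBlock_step_of_ne k φ _ _ h).1, happ]
      congr 2 <;> omega

/-- The output lags `k` letters behind the input, since the first window is complete only with
letter `k + 1`. -/
lemma slidingBlock_outputUpTo [Finite A] (k : ℕ) (φ : (Fin (k + 1) → A) → B) (α : ℕ → A) (n : ℕ) :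
    (slidingBlock k φ).outputUpTo α n =
      pref (fun i => φ fun j => α (i + j)) (n - k) := by
  induction n with
  | zero => simp [outputUpTo, pref]
  | succ n ih =>
    have hst := slidingBlock_stateAt k φ α n
    have hlen : ((slidingBlock k φ).stateAt α n).1.length = min n k := by rw [hst]; simp
    rw [outputUpTo, ih]
    by_cases h : ((slidingBlock k φ).stateAt α n).1.length = k
    · have hk : k ≤ n := by omega
      have happ : ((slidingBlock k φ).stateAt α n).1 ++ [α n] =
          (List.range' (n - k) (k + 1)).map α := by
        rw [hst, min_eq_right hk, List.range'_1_concat, List.map_append, List.map_singleton]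
        congr 3
        omega
      have : ((slidingBlock k φ).step ((slidingBlock k φ).stateAt α n) (α n)).2 =
          [φ fun j => α (n - k + j)] := by
        rw [(slidingBlock_step_of_eq k φ _ _ h).2]
        congr 2
        funext j
        simp only [happ]
        simp
      rw [this, Nat.succ_sub hk, pref_succ]
    · have hk : n < k := by omega
      rw [(slidingBlock_step_of_ne k φ _ _ h).2, List.append_nil]
      congr 1
      omega

lemma slidingBlock_outputs [Finite A] (k : ℕ) (φ : (Fin (k + 1) → A) → B) (α : ℕ → A) :
    (slidingBlock k φ).Outputs α fun i => φ fun j => α (i + j) := by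
  refine ⟨fun n i hi => ?_, fun l => ⟨l + k, ?_⟩⟩
  · simp [slidingBlock_outputUpTo, pref]
  · simp [slidingBlock_outputUpTo, pref]

end Transducer

/-! ### Itineraries in the coding graph and the recovery of a path from its code. -/

variable [Fintype V] [Fintype Ed]

namespace CodingSet

variable {J : CodingSet E}

lemma codeLabel_take (ω : J.graph.InfPath) (n m : ℕ) :
    codeLabel (ω.take n m) = (List.range' n (m + 1)).map (codeLabelInf ω) := by
  rw [codeLabel, vertices_take, List.map_map]
  rfl

/-- For a left-synchronizing coding graph, a window of the label determines the vertex at which the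
window begins. -/
lemma LeftSynchronizing.exists_window (h : J.LeftSynchronizing) :
    ∃ m, ∀ (ω ω' : J.graph.InfPath) (n n' : ℕ),
      (∀ j < m + 1, codeLabelInf ω (n + j) = codeLabelInf ω' (n' + j)) →
      J.graph.src (ω.1 n) = J.graph.src (ω'.1 n') := by
  obtain ⟨m, hm⟩ := h
  refine ⟨m, fun ω ω' n n' h => hm (ω.take n m) (ω'.take n' m) (length_take _ _ _)
    (length_take _ _ _) ?_⟩
  rw [codeLabel_take, codeLabel_take]
  refine List.ext_getElem (by simp) fun i h1 h2 => ?_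
  simpa using h i (by simpa using h1)

/-- The coding graph has at most one edge between two given vertices. -/
lemma edge_ext {ω ω' : J.graph.InfPath} {n n' : ℕ}
    (h : J.graph.src (ω.1 n) = J.graph.src (ω'.1 n'))
    (h' : J.graph.src (ω.1 (n + 1)) = J.graph.src (ω'.1 (n' + 1))) : ω.1 n = ω'.1 n' :=
  Subtype.ext (Prod.ext h ((ω.2 n).trans (h'.trans (ω'.2 n').symm)))

/-- A label `S_α^*` of non-negative degree has `|α| = 0`, and `P_v^* = P_v`. -/
lemma Edge.IsNonneg.exists_path {η : J.Edge} (h : η.IsNonneg) :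
    ∃ γ : E.FinPath, η.label = Leavitt.path γ := by
  obtain ⟨d, ⟨γ, h1, -⟩ | ⟨γ, h1, h2⟩, h3⟩ := h
  · exact ⟨γ, h1⟩
  · have h0 : γ.length = 0 := by omega
    refine ⟨γ, h1.trans ?_⟩
    have he : γ.edges = [] := List.length_eq_zero_iff.1 h0
    rw [Leavitt.path, he]
    simp [Leavitt.star_P]

/-- If all labels from `N` on had length `0`, a vertex visited twice after `N` would close a cycle
of edges of degree `0`. -/
lemma exists_pos_length (hcycles : ¬ J.HasNonposCycle) {γ : J.Edge → E.FinPath}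
    (hγ : ∀ η : J.Edge, η.label = Leavitt.path (γ η)) (ω : J.graph.InfPath) (N : ℕ) :
    ∃ n ≥ N, 0 < (γ (ω.1 n)).length := by
  by_contra! hc
  obtain ⟨n, n', hne, heq⟩ :=
    Finite.exists_ne_map_eq_of_infinite fun n => J.graph.src (ω.1 (N + n))
  wlog hlt : n < n' generalizing n n'
  · exact this n' n hne.symm heq.symm (by omega)
  refine hcycles ⟨ω.take (N + n) (n' - n), ⟨?_, ?_⟩, fun η hη => ?_⟩
  · rw [length_take]; omega
  · refine (finish_take ω _ _).trans (Eq.trans ?_ heq.symm)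
    rw [show N + n + (n' - n) = N + n' by omega]
  · obtain ⟨i, hi, rfl⟩ := List.mem_map.1 hη
    have := hc i (by have := (List.mem_range'_1.1 hi).1; omega)
    exact ⟨0, .inl ⟨_, hγ _, by rw [Nat.le_zero.1 this]; rfl⟩, le_rfl⟩

variable (hu : J.u ∈ unitary (Leavitt E))

/-- With `α = μβ` and `next α = κβ = μ'β'`, the operator `s_κ^* s_{μ'}` takes `δ_{β'}` to `δ_β`. So
consecutive pairs are joined by an edge, whose label turns the later remainder into the earlier one.
-/
lemma l2_label_delta (α : E.InfPath) :
    star (CKFamily.l2.path (vtx hu α).kappa) (CKFamily.l2.path (vtx hu (next hu α)).mu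
      (delta ((next hu α).drop (vtx hu (next hu α)).mu.length))) =
      delta (α.drop (vtx hu α).mu.length) := by
  rw [CKFamily.l2_path_delta (vtx_isInitial hu _), CKFamily.l2_star_path_delta (next_isInitial hu α),
    next_drop]

lemma ofLeavitt_label {A : Type*} [CStarAlgebra A] (F : CKFamily E A) (x y : J.Vertex) :
    F.ofLeavitt (star (Leavitt.path x.kappa) * Leavitt.path y.mu) =
      star (F.path x.kappa) * F.path y.mu := by
  rw [map_mul, CKFamily.ofLeavitt_star, CKFamily.ofLeavitt_path, CKFamily.ofLeavitt_path]

lemma label_ne_zero (α : E.InfPath) :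
    star (Leavitt.path (vtx hu α).kappa) * Leavitt.path (vtx hu (next hu α)).mu ≠ 0 := by
  intro h
  have h1 := ofLeavitt_label (CKFamily.l2 (E := E)) (vtx hu α) (vtx hu (next hu α))
  rw [h, map_zero] at h1
  have h2 := l2_label_delta hu α
  rw [← mul_apply_eq_comp, ← h1] at h2
  exact delta_ne_zero _ h2.symm

/-- The infinite path in the coding graph along which the iterates of `next` move. -/
def itinerary (α : E.InfPath) : J.graph.InfPath :=
  ⟨fun n => ⟨(vtx hu ((next hu)^[n] α), vtx hu ((next hu)^[n + 1] α)), by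
    rw [Function.iterate_succ_apply']; exact label_ne_zero hu _⟩, fun _ => rfl⟩

lemma codeLabelInf_itinerary (α : E.InfPath) :
    codeLabelInf (itinerary hu α) = (code hu α).1 :=
  funext fun n => (pre_zero hu ((next hu)^[n] α)).symm

variable {γ : J.Edge → E.FinPath}

lemma labelling_stateAt (ω : ℕ → J.Edge) (n : ℕ) :
    (J.labelling γ).stateAt ω (n + 1) = some (ω n) := by
  rw [Transducer.stateAt]
  cases (J.labelling γ).stateAt ω n <;> rfl

lemma labelling_outputUpTo_succ (ω : ℕ → J.Edge) (n : ℕ) :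
    (J.labelling γ).outputUpTo ω (n + 2) =
      (J.labelling γ).outputUpTo ω (n + 1) ++ (γ (ω n)).edges := by
  rw [Transducer.outputUpTo, labelling_stateAt]
  rfl

variable (hγ : ∀ η : J.Edge, η.label = Leavitt.path (γ η))
include hγ

lemma label_isInitial (α : E.InfPath) (n : ℕ) :
    (γ ((itinerary hu α).1 n)).IsInitial
      (((next hu)^[n] α).drop (vtx hu ((next hu)^[n] α)).mu.length) ∧
    (((next hu)^[n] α).drop (vtx hu ((next hu)^[n] α)).mu.length).drop
      (γ ((itinerary hu α).1 n)).length =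
      ((next hu)^[n + 1] α).drop (vtx hu ((next hu)^[n + 1] α)).mu.length := by
  apply CKFamily.isInitial_of_l2_path_delta
  rw [← l2_label_delta hu ((next hu)^[n] α), ← mul_apply_eq_comp, ← ofLeavitt_label,
    ← CKFamily.ofLeavitt_path, ← hγ, Function.iterate_succ_apply']
  -- The itinerary is written with `(next hu)^[n + 1]`, which equals one further application of
  -- `next` only up to rewriting.
  have h : (itinerary hu α).1 n = ⟨(vtx hu ((next hu)^[n] α), vtx hu (next hu ((next hu)^[n] α))),
      label_ne_zero hu _⟩ := by
    apply Subtype.ext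
    simp only [itinerary, Function.iterate_succ_apply']
  rw [h]
  rfl

/-- Invariant of the labelling transducer: the word `μ_0 γ_0 ⋯ γ_{n-1}` written so far, followed by
the remainder of the `n`-th iterate, is `α`. The shift to `n + 1` letters arises because the first
letter only writes `μ_0`. -/
lemma appendStream_outputUpTo (α : E.InfPath) (n : ℕ) :
    (α.1 : Stream' Ed) =
      Stream'.appendStream' ((J.labelling γ).outputUpTo (itinerary hu α).1 (n + 1))
        (((next hu)^[n] α).drop (vtx hu ((next hu)^[n] α)).mu.length).1 := by
  induction n with
  | zero => exact (vtx_isInitial hu α).appendStream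
  | succ n ih =>
    obtain ⟨h1, h2⟩ := label_isInitial hu hγ α n
    rw [labelling_outputUpTo_succ, ← h2]
    exact (ih.trans (congrArg _ h1.appendStream)).trans
      (Stream'.append_append_stream _ _ _).symm

lemma labelling_outputs (hcycles : ¬ J.HasNonposCycle) (α : E.InfPath) :
    (J.labelling γ).Outputs (itinerary hu α).1 α.1 := by
  refine ⟨fun n i hi => ?_, fun k => ?_⟩
  · cases n with
    | zero => exact absurd hi (Nat.not_lt_zero i)
    | succ n =>
      have h := congrFun (appendStream_outputUpTo hu hγ α n) i
      exact (h.trans (Stream'.get_append_left _ _ _ hi)).symm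
  · induction k with
    | zero => exact ⟨0, Nat.zero_le _⟩
    | succ k ih =>
      obtain ⟨N, hN⟩ := ih
      obtain ⟨n, hn, hpos⟩ := exists_pos_length hcycles hγ (itinerary hu α) N
      refine ⟨n + 2, ?_⟩
      rw [labelling_outputUpTo_succ, List.length_append]
      have h1 := (J.labelling γ).length_outputUpTo_mono (itinerary hu α).1
        (show N ≤ n + 1 by omega)
      have h2 : 0 < (γ ((itinerary hu α).1 n)).edges.length := hpos
      simp only at h1
      omega

/-- Synchronization makes the code determine the itinerary, and the output of the labelling
transducer on the itinerary is the path itself. -/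
lemma code_injective (hcycles : ¬ J.HasNonposCycle) (hsync : J.LeftSynchronizing) :
    Function.Injective (code hu) := by
  intro α β h
  obtain ⟨m, hm⟩ := hsync.exists_window
  have hsrc : ∀ n, J.graph.src ((itinerary hu α).1 n) = J.graph.src ((itinerary hu β).1 n) :=
    fun n => hm _ _ n n fun j _ => by
      rw [codeLabelInf_itinerary, codeLabelInf_itinerary, h]
  have hit : itinerary hu α = itinerary hu β :=
    InfPath.ext fun n => edge_ext (hsrc n) (hsrc (n + 1))
  have h1 := labelling_outputs hu hγ hcycles α
  rw [hit] at h1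
  exact Subtype.ext (h1.unique (labelling_outputs hu hγ hcycles β))

end CodingSet
end

/-! ### Sliding block codes and the inverse of the coding map. -/

noncomputable section
variable {V Ed : Type u} {E : DiGraph V Ed}
open DiGraph InfPath PEquiv

/-- A map between spaces of infinite paths in which every letter of the image depends only on a
window of fixed length is a sliding block code, computed by a transducer. -/
lemma exists_slidingBlock [Fintype Ed] {V' Ed' : Type u} {E' : DiGraph V' Ed'}
    (hE : Nonempty Ed → Nonempty E.InfPath) (Φ : E.InfPath → E'.InfPath) (k : ℕ)
    (h : ∀ (α β : E.InfPath) (n n' : ℕ), (∀ j < k + 1, α.1 (n + j) = β.1 (n' + j)) →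
      (Φ α).1 n = (Φ β).1 n') :
    IsSlidingBlockCode Φ ∧ ∃ T : Transducer Ed Ed', ∀ α : E.InfPath, T.Outputs α.1 (Φ α).1 := by
  classical
  let φ : (Fin (k + 1) → Ed) → Ed' := fun w =>
    if hw : ∃ p : E.InfPath × ℕ, w = fun j : Fin (k + 1) => p.1.1 (p.2 + j) then
      (Φ hw.choose.1).1 hw.choose.2
    -- A junk value for words that occur in no infinite path; the window has length at least `1`, so
    -- `w 0` shows that there are edges, hence infinite paths.
    else (Φ (hE ⟨w 0⟩).some).1 0
  have hφ : ∀ (α : E.InfPath) n, (Φ α).1 n = φ fun j => α.1 (n + j) := by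
    intro α n
    have hw : ∃ p : E.InfPath × ℕ,
        (fun j : Fin (k + 1) => α.1 (n + j)) = fun j : Fin (k + 1) => p.1.1 (p.2 + j) := ⟨(α, n), rfl⟩
    have hd : φ (fun j => α.1 (n + j)) = (Φ hw.choose.1).1 hw.choose.2 := dif_pos hw
    rw [hd]
    exact h _ _ _ _ fun j hj => congrFun hw.choose_spec ⟨j, hj⟩
  refine ⟨⟨k + 1, φ, hφ⟩, Transducer.slidingBlock k φ, fun α => ?_⟩
  rw [show (Φ α).1 = fun n => φ fun j => α.1 (n + j) from funext (hφ α)]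
  exact Transducer.slidingBlock_outputs k φ α.1

section

attribute [local instance] GraphCStar.diagonalCommCStarAlgebra

open WeakDual in
lemma CodingSet.diagonalHom_bijective [Fintype V] [Fintype Ed] {J : CodingSet E}
    (hu : J.u ∈ unitary (Leavitt E)) (h : Function.Bijective (code hu)) :
    Function.Bijective (diagonalHom hu) := by
  apply StarAlgHom.bijective_of_bijective_comp
  have : (CharacterSpace.compContinuousMap (diagonalHom hu) : _ → _) =
      GraphCStar.pathSpectrum ∘ code hu ∘ GraphCStar.pathSpectrum.symm := by
    funext χ
    rw [Function.comp_apply, Function.comp_apply, ← comp_diagonalHom, Homeomorph.apply_symm_apply]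
  rw [this]
  exact GraphCStar.pathSpectrum.bijective.comp (h.comp GraphCStar.pathSpectrum.symm.bijective)

end

end

theorem mainTheorem4 {V Ed : Type u} [Fintype V] [Fintype Ed] (E : DiGraph V Ed)
    (hsinks : E.NoSinks) (hsources : E.NoSources) (hexits : E.CyclesHaveExits)
    (J : CodingSet E) (hu : J.u ∈ unitary (Leavitt E))
    (hnonneg : ∀ η : J.Edge, η.IsNonneg) (hcycles : ¬ J.HasNonposCycle)
    (hsync : J.LeftSynchronizing) :
    ∃ (Γ : E.InfPath ≃ₜ WeakDual.characterSpace ℂ (GraphCStar.diagonal E))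
      (Λ : GraphCStar.diagonal E ≃⋆ₐ[ℂ] GraphCStar.diagonal E),
      GraphCStar.IsPathSpectrum Γ ∧
      (∀ x : GraphCStar.diagonal E, (Λ x : GraphCStar E) = J.lambda hu (x : GraphCStar E)) ∧
      ∃ T : Transducer Ed Ed,
        (∀ α : E.InfPath, T.Outputs α.1 ((GraphCStar.pathHomeo Γ Λ).symm α).1) ∧
        ∃ (Φ : E.InfPath → J.graph.InfPath) (T₁ : Transducer Ed J.Edge)
          (γ : J.Edge → E.FinPath),
          IsSlidingBlockCode Φ ∧
          (∀ α : E.InfPath, CodingSet.codeLabelInf (Φ α) = α.1) ∧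
          (∀ α : E.InfPath, T₁.Outputs α.1 (Φ α).1) ∧
          (∀ η : J.Edge, η.label = Leavitt.path (γ η)) ∧
          T = (J.labelling γ).comp T₁ := by
  choose γ hγ using fun η => (hnonneg η).exists_path
  have hbij : Function.Bijective (CodingSet.code hu) :=
    ⟨CodingSet.code_injective hu hγ hcycles hsync, CodingSet.code_surjective hu hsinks⟩
  let Λ : GraphCStar.diagonal E ≃⋆ₐ[ℂ] GraphCStar.diagonal E :=
    StarAlgEquiv.ofBijective (CodingSet.diagonalHom hu) (CodingSet.diagonalHom_bijective hu hbij)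
  refine ⟨GraphCStar.pathSpectrum, Λ, GraphCStar.isPathSpectrum, fun x => rfl, ?_⟩
  set ψ := (GraphCStar.pathHomeo GraphCStar.pathSpectrum Λ).symm with hψ
  -- The homeomorphism dual to `Λ` is `code`, so `ψ` is its inverse.
  have hcode : ∀ α, CodingSet.code hu (ψ α) = α := fun α => by
    have h : ∀ β, GraphCStar.pathHomeo GraphCStar.pathSpectrum Λ β = CodingSet.code hu β :=
      fun β => (congrArg GraphCStar.pathSpectrum.symm (CodingSet.comp_diagonalHom hu β)).trans
        (GraphCStar.pathSpectrum.symm_apply_apply _)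
    rw [← h, hψ, Homeomorph.apply_symm_apply]
  have hlabel : ∀ α, CodingSet.codeLabelInf (CodingSet.itinerary hu (ψ α)) = α.1 := fun α => by
    rw [CodingSet.codeLabelInf_itinerary, hcode]
  obtain ⟨m, hm⟩ := hsync.exists_window
  obtain ⟨hΦ, T₁, hT₁⟩ := exists_slidingBlock
    (fun ⟨e⟩ => ⟨(hsinks.exists_infPath (E.src e)).choose⟩)
    -- The `m + 1` letters from position `n` determine the source of the `n`-th edge and those from
    -- position `n + 1` its range; together they form a window of length `m + 2`.
    (fun α => CodingSet.itinerary hu (ψ α)) (m + 1) fun α β n n' h => by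
      refine CodingSet.edge_ext (hm _ _ _ _ fun j hj => ?_) (hm _ _ _ _ fun j hj => ?_)
      · rw [hlabel, hlabel]
        exact h j (by omega)
      · rw [hlabel, hlabel, Nat.add_assoc, Nat.add_assoc]
        exact h (1 + j) (by omega)
  exact ⟨(J.labelling γ).comp T₁,
    fun α => (hT₁ α).comp (CodingSet.labelling_outputs hu hγ hcycles (ψ α)),
    fun α => CodingSet.itinerary hu (ψ α), T₁, γ, hΦ, hlabel, hT₁, hγ, rfl⟩
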